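/- **Setting.** Let $\Theta\subset\mathbb R^d$ be open and, for each $i\ge 1$, let $f_i(\cdot|\theta)$, $\theta\in\Theta$, be probability densities on $\mathbb R^t$ with respect to a measure $\nu_i$ (Lebesgue measure: densities; counting measure: mass functions). Fix $\theta_0\in\Theta$ and let $X_1,X_2,\dots$ be independent random vectors, $X_i$ having density $f_i(\cdot|\theta_0)$; $\mathrm E$ and $\mathbb P$ refer to this law. Put $L_n(\theta;x)=\prod_{i=1}^n f_i(x_i|\theta)$, $l_n=\log L_n$, and write $X=(X_1,\dots,X_n)$. Assume that, for the sample size $n\ge1$ under consideration and for all sufficiently large sample sizes $m$, almost surely there is a unique maximiser $\hat\theta_m=\hat\theta_m(X_1,\dots,X_m)\in\Theta$ of $L_m(\cdot;X_1,\dots,X_m)$ over $\Theta$, where $\hat\theta_m$ is a measurable function of the sample. Let $J_k(x,\theta)$ be the Hessian of $\log f_k(x|\cdot)$ at $\theta$, $I_k(\theta)=-\mathrm E[J_k(X_k,\theta)]$ and $\bar I_m(\theta)=\frac1m\sum_{k=1}^m I_k(\theta)$. **Regularity conditions.** - (N1) $\hat\theta_m\to\theta_0$ in probability as $m\to\infty$.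 - (N2) For every $k$, almost surely, for all $\theta\in\Theta$: $f_k(X_k|\theta)>0$, and $\log f_k(X_k|\cdot)$ and its first partial derivatives are differentiable at $\theta$. - (N3) For every $k$, almost surely, $J_k(X_k,\cdot)$ is continuous on $\Theta$; $J_k(\cdot,\theta)$ is measurable (up to null sets of the law of $X_k$) for each $\theta\in\Theta$. - (N4) $\mathrm E[\nabla\log f_k(X_k|\theta_0)]=0$ for all $k$. - (N5) $\mathrm E\big[\nabla\log f_k(X_k|\theta_0)\,\nabla\log f_k(X_k|\theta_0)^{\intercal}\big]=-\mathrm E[J_k(X_k,\theta_0)]$ for all $k$, all entries being integrable. - (N6) The matrices $\bar I_m(\theta_0)$ are symmetric and converge, as $m\to\infty$, to a symmetric positive definite matrix. - (N7) For some $\delta>0$, $m^{-(2+\delta)/2}\sum_{k=1}^m\mathrm E|\lambda^{\intercal}\nabla\log f_k(X_k|\theta_0)|^{2+\delta}\to0$ as $m\to\infty$ for all $\lambda\in\mathbb R^d$. - (N8) For every $k\ge 1$ and $i,j\in\{1,\dots,d\}$ there are $\epsilon',K,\delta>0$ and a random variable $B_{k,ij}(X_k)$ such that almost surely $\big|\frac{\partial^2}{\partial\theta_i\partial\theta_j}\log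 f_k(X_k|\theta)\big|\le B_{k,ij}(X_k)$ for all $\theta\in\Theta$ with $\|\theta-\theta_0\|\le\epsilon'$, and $\mathrm E|B_{k,ij}(X_k)|^{1+\delta}\le K$. **Further assumptions for the given $n$.** The matrix $\bar I_n(\theta_0)$ is positive definite. There are $\epsilon>0$ and measurable functions $M_{kjl}$ of the sample, $k,j,l\in\{1,\dots,d\}$, such that, with $\Theta_\epsilon=\{\theta\in\Theta:|\theta_j-\theta_{0,j}|<\epsilon\ \forall j\}$: - for every $\theta\in\Theta_\epsilon$ the segment from $\theta_0$ to $\theta$ lies in $\Theta_\epsilon$ (automatic if $\Theta$ is convex, or if the open cube of half-side $\epsilon$ around $\theta_0$ lies in $\Theta$); - almost surely, for all $\theta\in\Theta_\epsilon$ and all $k,j,l$, the second partial derivatives of $l_n(\cdot;X)$ are differentiable at $\theta$ and $\big|\frac{\partial^3}{\partial\theta_k\partial\theta_j\partial\theta_l}l_n(\theta;X)\big|\le M_{kjl}(X)$; - $\mathrm E\big(M_{kjl}(X)^2\,\big|\,|Q_{(m)}|<\epsilon\big)<\infty$ for all $k,j,l$, where $|Q_{(m)}|=\max_j|\hat\theta_n(X)_j-\theta_{0,j}|$.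 (A conditional expectation given a null event is read as $0$.) **Conclusion.** Let $h:\mathbb R^d\to\mathbb R$ be three times differentiable with bounded partial derivatives of orders one, two and three. Let $\|h\|=\sup|h|\in[0,\infty]$, and let $\|h\|_1,\|h\|_2,\|h\|_3$ be the suprema, over $\mathbb R^d$ and over all indices, of the absolute values of the partial derivatives of $h$ of orders one, two and three. Let $Z\sim \mathrm N_d(0,I_{d\times d})$ and let $(X_i')$ be an independent copy of $(X_i)$. Then $$\Big|\mathrm E\big[h\big(\sqrt n\,[\bar I_n(\theta_0)]^{1/2}(\hat\theta_n(X)-\theta_0)\big)\big]-\mathrm E[h(Z)]\Big|\le\frac{\|h\|_1}{\sqrt n}K_1+\frac{\|h\|_2}{\sqrt n}K_2+\frac{\|h\|_3}{\sqrt n}K_3+\frac{2\|h\|}{\epsilon^2}\,\mathrm E\Big(\sum_{j=1}^d(\hat\theta_n(X)_j-\theta_{0,j})^2\Big),$$ where, with $A=[\bar I_n(\theta_0)]^{-1/2}$ (symmetric positive definite root), $$K_1=\sum_{k,l=1}^d|A_{lk}|\sum_{j=1}^d\sqrt{\mathrm E\big[(\hat\theta_n(X)_j-\theta_{0,j})^2\big]\,\mathrm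 E\Big[\Big(\tfrac{\partial^2}{\partial\theta_j\partial\theta_k}l_n(\theta_0;X)+n[\bar I_n(\theta_0)]_{kj}\Big)^2\Big]}$$ $$\qquad+\frac12\sum_{k,l=1}^d|A_{lk}|\sum_{j,v=1}^d\Big[\mathrm E\big((\hat\theta_n(X)_j-\theta_{0,j})^2(\hat\theta_n(X)_v-\theta_{0,v})^2\big)\Big]^{1/2}\Big[\mathrm E\big(M_{kjv}(X)^2\,\big|\,|Q_{(m)}|<\epsilon\big)\Big]^{1/2},$$ $$K_2=\frac1{4\sqrt n}\sum_{j=1}^d\Big[\sum_{i=1}^n\mathrm{Var}\Big(\Big(\sum_{k=1}^dA_{jk}\tfrac{\partial}{\partial\theta_k}\log f_i(X_i|\theta_0)\Big)^2\Big)\Big]^{1/2}$$ $$\qquad+\frac1{2\sqrt n}\sum_{k=1}^{d-1}\sum_{j>k}\Big[\sum_{i=1}^n\mathrm{Var}\Big(\sum_{q,v=1}^dA_{jq}A_{kv}\tfrac{\partial}{\partial\theta_q}\log f_i(X_i|\theta_0)\,\tfrac{\partial}{\partial\theta_v}\log f_i(X_i|\theta_0)\Big)\Big]^{1/2},$$ $$K_3=\frac1{12n}\sum_{i=1}^n\mathrm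 E\Big(\sum_{m=1}^d\Big|\sum_{l=1}^dA_{ml}\,\tfrac{\partial}{\partial\theta_l}\big\{\log f_i(X_i'|\theta_0)-\log f_i(X_i|\theta_0)\big\}\Big|\Big)^3.$$ The right-hand side may be infinite; it is evaluated in $[0,\infty]$ with $0\cdot\infty=0$. -/

import Mathlib

open MeasureTheory ProbabilityTheory Filter Topology
open scoped ENNReal MatrixOrder

noncomputable section

namespace MLEBound

/-- `ℝ^d` with the Euclidean norm. -/
abbrev Vec (d : ℕ) := EuclideanSpace ℝ (Fin d)

/-- The partial derivative `∂g/∂θ_k` at `θ`. -/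
def pderiv {d : ℕ} (k : Fin d) (g : Vec d → ℝ) (θ : Vec d) : ℝ :=
  fderiv ℝ g θ (EuclideanSpace.single k 1)

/-- Square root on `[0,∞]`. -/
def esqrt (a : ℝ≥0∞) : ℝ≥0∞ := a ^ (1 / 2 : ℝ)

section TestFunctions

variable {d : ℕ}

/-- The supremum norm `‖h‖ ∈ [0,∞]`. -/
def supNorm (h : Vec d → ℝ) : ℝ≥0∞ := ⨆ x, ‖h x‖ₑ

/-- `‖h‖₁ = sup_i ‖∂_i h‖`. -/
def supNorm1 (h : Vec d → ℝ) : ℝ≥0∞ := ⨆ i, supNorm (pderiv i h)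

/-- `‖h‖₂ = sup_{i,j} ‖∂_i ∂_j h‖`. -/
def supNorm2 (h : Vec d → ℝ) : ℝ≥0∞ := ⨆ i, ⨆ j, supNorm (pderiv i (pderiv j h))

/-- `‖h‖₃ = sup_{i,j,k} ‖∂_i ∂_j ∂_k h‖`. -/
def supNorm3 (h : Vec d → ℝ) : ℝ≥0∞ :=
  ⨆ i, ⨆ j, ⨆ k, supNorm (pderiv i (pderiv j (pderiv k h)))

/-- The class `H`: three times differentiable functions whose derivatives of orders
one, two and three are bounded. -/
structure IsTestFunction (h : Vec d → ℝ) : Prop where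
  diff1 : Differentiable ℝ h
  diff2 : ∀ i, Differentiable ℝ (pderiv i h)
  diff3 : ∀ i j, Differentiable ℝ (pderiv i (pderiv j h))
  bdd1 : supNorm1 h < ∞
  bdd2 : supNorm2 h < ∞
  bdd3 : supNorm3 h < ∞

end TestFunctions

section Likelihood

variable {t d : ℕ}

/-- `log f_i(x|θ)` as a function of `θ`; observations are numbered from `0`. -/
def logDens (f : ℕ → Vec t → Vec d → ℝ) (i : ℕ) (x : Vec t) (θ : Vec d) : ℝ :=
  Real.log (f i x θ)

/-- `∂/∂θ_k log f_i(x|θ)`. -/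
def score (f : ℕ → Vec t → Vec d → ℝ) (i : ℕ) (k : Fin d) (x : Vec t) (θ : Vec d) : ℝ :=
  pderiv k (logDens f i x) θ

/-- The entry `∂²/∂θ_a∂θ_b log f_i(x|θ)` of the Hessian matrix `J_i(x,θ)`. -/
def hess (f : ℕ → Vec t → Vec d → ℝ) (i : ℕ) (a b : Fin d) (x : Vec t) (θ : Vec d) : ℝ :=
  pderiv a (pderiv b (logDens f i x)) θ

/-- The likelihood `L(θ;x) = ∏_i f_i(x_i|θ)` of a sample of size `n`. -/
def likelihood (f : ℕ → Vec t → Vec d → ℝ) (n : ℕ) (x : Fin n → Vec t) (θ : Vec d) : ℝ :=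
  ∏ i : Fin n, f i (x i) θ

/-- The log-likelihood `l(θ;x)`. -/
def logLik (f : ℕ → Vec t → Vec d → ℝ) (n : ℕ) (x : Fin n → Vec t) (θ : Vec d) : ℝ :=
  Real.log (likelihood f n x θ)

/-- `θ'` is the unique maximiser over `Θ` of the likelihood of the sample `x`. -/
def IsUniqueMLE (f : ℕ → Vec t → Vec d → ℝ) (Θ : Set (Vec d)) (n : ℕ) (x : Fin n → Vec t)
    (θ' : Vec d) : Prop :=
  θ' ∈ Θ ∧ ∀ θ ∈ Θ, θ ≠ θ' → likelihood f n x θ < likelihood f n x θ'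

/-- `f_i(·|θ)` is a probability density with respect to the measure `ν_i`, for every `i` and
every `θ ∈ Θ` (Lebesgue measure gives densities, counting measure gives mass functions). -/
structure IsModel (ν : ℕ → Measure (Vec t)) (f : ℕ → Vec t → Vec d → ℝ) (Θ : Set (Vec d)) :
    Prop where
  measurable : ∀ i, ∀ θ ∈ Θ, Measurable fun x => f i x θ
  nonneg : ∀ i x, ∀ θ ∈ Θ, 0 ≤ f i x θ
  total : ∀ i, ∀ θ ∈ Θ, ∫⁻ x, ENNReal.ofReal (f i x θ) ∂(ν i) = 1

end Likelihood

section Sampling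

variable {Ω : Type*} [MeasurableSpace Ω] {t d : ℕ}

/-- The sample `(X_1, …, X_n)`. -/
def sample (X : ℕ → Ω → Vec t) (n : ℕ) (ω : Ω) : Fin n → Vec t := fun i => X i ω

/-- The observations are independent, and `X_i` has density `f_i(·|θ₀)` with respect to `ν_i`. -/
structure IsObservation (P : Measure Ω) (X : ℕ → Ω → Vec t) (ν : ℕ → Measure (Vec t))
    (f : ℕ → Vec t → Vec d → ℝ) (θ₀ : Vec d) : Prop where
  measurable : ∀ i, Measurable (X i)
  indep : iIndepFun X P
  law : ∀ i, P.map (X i) = (ν i).withDensity fun x => ENNReal.ofReal (f i x θ₀)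

/-- `I_k(θ) = -E[J_k(X_k,θ)]`. -/
def fisher (P : Measure Ω) (X : ℕ → Ω → Vec t) (f : ℕ → Vec t → Vec d → ℝ) (k : ℕ)
    (θ : Vec d) : Matrix (Fin d) (Fin d) ℝ :=
  Matrix.of fun a b => -∫ ω, hess f k a b (X k ω) θ ∂P

/-- `Ī_n(θ) = (1/n) ∑_k I_k(θ)`. -/
def avgFisher (P : Measure Ω) (X : ℕ → Ω → Vec t) (f : ℕ → Vec t → Vec d → ℝ) (n : ℕ)
    (θ : Vec d) : Matrix (Fin d) (Fin d) ℝ :=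
  (n : ℝ)⁻¹ • ∑ k ∈ Finset.range n, fisher P X f k θ

/-- The regularity conditions at the true parameter `θ₀`, where `θhat n` is the estimator based
on a sample of size `n` and `P` is the probability under `θ₀`. -/
structure Regularity (P : Measure Ω) (X : ℕ → Ω → Vec t) (f : ℕ → Vec t → Vec d → ℝ)
    (Θ : Set (Vec d)) (θ₀ : Vec d) (θhat : (n : ℕ) → (Fin n → Vec t) → Vec d) : Prop where
  /-- Consistency. -/
  consistent : TendstoInMeasure P (fun n ω => θhat n (sample X n ω)) atTop (fun _ => θ₀)
  /-- Almost surely, `log f_k(X_k|θ)` is finite and its gradient and Hessian exist on `Θ`. -/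
  pos : ∀ k, ∀ᵐ ω ∂P, ∀ θ ∈ Θ, 0 < f k (X k ω) θ
  grad_exists : ∀ k, ∀ᵐ ω ∂P, ∀ θ ∈ Θ, DifferentiableAt ℝ (logDens f k (X k ω)) θ
  hess_exists : ∀ k, ∀ᵐ ω ∂P, ∀ θ ∈ Θ, ∀ b,
    DifferentiableAt ℝ (pderiv b (logDens f k (X k ω))) θ
  /-- Almost surely the Hessian is continuous in `θ`, and it is measurable in the observation. -/
  hess_cont : ∀ k, ∀ᵐ ω ∂P, ∀ a b, ContinuousOn (fun θ => hess f k a b (X k ω) θ) Θ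
  hess_meas : ∀ k, ∀ θ ∈ Θ, ∀ a b, AEMeasurable (fun x => hess f k a b x θ) (P.map (X k))
  /-- The score has mean zero. -/
  score_integrable : ∀ k a, Integrable (fun ω => score f k a (X k ω) θ₀) P
  score_mean : ∀ k a, ∫ ω, score f k a (X k ω) θ₀ ∂P = 0
  /-- The information equality. -/
  prod_integrable : ∀ k a b,
    Integrable (fun ω => score f k a (X k ω) θ₀ * score f k b (X k ω) θ₀) P
  hess_integrable : ∀ k a b, Integrable (fun ω => hess f k a b (X k ω) θ₀) P
  info_eq : ∀ k a b,
    ∫ ω, score f k a (X k ω) θ₀ * score f k b (X k ω) θ₀ ∂P = -∫ ω, hess f k a b (X k ω) θ₀ ∂P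
  /-- The average information matrices are symmetric and converge to a symmetric positive
  definite matrix. -/
  fisher_symm : ∀ n, (avgFisher P X f n θ₀).IsSymm
  fisher_lim : ∃ I : Matrix (Fin d) (Fin d) ℝ,
    Tendsto (fun n => avgFisher P X f n θ₀) atTop (𝓝 I) ∧ I.IsSymm ∧ I.PosDef
  /-- The Lyapunov condition. -/
  lyapunov : ∃ δ : ℝ, 0 < δ ∧ ∀ c : Fin d → ℝ,
    Tendsto (fun n : ℕ => (∑ k ∈ Finset.range n,
        ∫⁻ ω, ‖∑ a, c a * score f k a (X k ω) θ₀‖ₑ ^ (2 + δ) ∂P) / (n : ℝ≥0∞) ^ ((2 + δ) / 2))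
      atTop (𝓝 0)
  /-- Local domination of the Hessian. -/
  hess_dom : ∀ (k : ℕ) (a b : Fin d), ∃ ε K δ : ℝ, 0 < ε ∧ 0 < K ∧ 0 < δ ∧
    ∃ B : Vec t → ℝ, Measurable B ∧
      (∀ᵐ ω ∂P, ∀ θ ∈ Θ, ‖θ - θ₀‖ ≤ ε → |hess f k a b (X k ω) θ| ≤ B (X k ω)) ∧
      ∫⁻ ω, ‖B (X k ω)‖ₑ ^ (1 + δ) ∂P ≤ ENNReal.ofReal K

/-- `|Q_(m)|`: the largest of the absolute values `|θ_j - θ₀_j|`. -/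
def maxDev (θ θ₀ : Vec d) : ℝ := ⨆ j, |θ j - θ₀ j|

/-- `P` conditioned on the event `|Q_(m)| < ε`, with `T` the estimator. It is the zero measure
if the event is null. -/
def condNear (P : Measure Ω) (X : ℕ → Ω → Vec t) (n : ℕ) (T : (Fin n → Vec t) → Vec d)
    (θ₀ : Vec d) (ε : ℝ) : Measure Ω :=
  P[|{ω | maxDev (T (sample X n ω)) θ₀ < ε}]

/-- `[Ī_n(θ₀)]^{1/2}`, the positive semidefinite square root. -/
def rootFisher (P : Measure Ω) (X : ℕ → Ω → Vec t) (f : ℕ → Vec t → Vec d → ℝ) (n : ℕ)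
    (θ₀ : Vec d) : Matrix (Fin d) (Fin d) ℝ :=
  CFC.sqrt (avgFisher P X f n θ₀)

/-- `[Ī_n(θ₀)]^{-1/2}`. -/
def invRootFisher (P : Measure Ω) (X : ℕ → Ω → Vec t) (f : ℕ → Vec t → Vec d → ℝ) (n : ℕ)
    (θ₀ : Vec d) : Matrix (Fin d) (Fin d) ℝ :=
  (rootFisher P X f n θ₀)⁻¹

/-- The standardised estimator `√n [Ī_n(θ₀)]^{1/2} (T(X) - θ₀)`. -/
def standardized (P : Measure Ω) (X : ℕ → Ω → Vec t) (f : ℕ → Vec t → Vec d → ℝ) (n : ℕ)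
    (T : (Fin n → Vec t) → Vec d) (θ₀ : Vec d) (ω : Ω) : Vec d :=
  WithLp.toLp 2 (Real.sqrt n •
    (rootFisher P X f n θ₀).mulVec fun j => T (sample X n ω) j - θ₀ j)

/-- `K₁(θ₀)`. -/
def K1 (P : Measure Ω) (X : ℕ → Ω → Vec t) (f : ℕ → Vec t → Vec d → ℝ) (n : ℕ)
    (T : (Fin n → Vec t) → Vec d) (θ₀ : Vec d) (ε : ℝ)
    (M : Fin d → Fin d → Fin d → (Fin n → Vec t) → ℝ) : ℝ≥0∞ :=
  ∑ k, ∑ l, ‖invRootFisher P X f n θ₀ l k‖ₑ * ∑ j,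
      esqrt ((∫⁻ ω, ‖T (sample X n ω) j - θ₀ j‖ₑ ^ 2 ∂P) *
        ∫⁻ ω, ‖pderiv j (pderiv k (logLik f n (sample X n ω))) θ₀
          + n * avgFisher P X f n θ₀ k j‖ₑ ^ 2 ∂P)
  + 2⁻¹ * ∑ k, ∑ l, ‖invRootFisher P X f n θ₀ l k‖ₑ * ∑ j, ∑ v,
      esqrt (∫⁻ ω, ‖T (sample X n ω) j - θ₀ j‖ₑ ^ 2 * ‖T (sample X n ω) v - θ₀ v‖ₑ ^ 2 ∂P) *
        esqrt (∫⁻ ω, ‖M k j v (sample X n ω)‖ₑ ^ 2 ∂(condNear P X n T θ₀ ε))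

/-- `K₂(θ₀)`. -/
def K2 (P : Measure Ω) (X : ℕ → Ω → Vec t) (f : ℕ → Vec t → Vec d → ℝ) (n : ℕ)
    (θ₀ : Vec d) : ℝ≥0∞ :=
  (4 * esqrt n)⁻¹ * ∑ j, esqrt (∑ i ∈ Finset.range n,
      evariance (fun ω => (∑ k, invRootFisher P X f n θ₀ j k * score f i k (X i ω) θ₀) ^ 2) P)
  + (2 * esqrt n)⁻¹ * ∑ k, ∑ j ∈ Finset.Ioi k, esqrt (∑ i ∈ Finset.range n,
      evariance (fun ω => ∑ q, ∑ v,
        invRootFisher P X f n θ₀ j q * invRootFisher P X f n θ₀ k v *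
          score f i q (X i ω) θ₀ * score f i v (X i ω) θ₀) P)

/-- `K₃(θ₀)`. On the product space `Ω × Ω` with the measure `P.prod P`, the variables
`p ↦ X i p.2` form an independent copy of the variables `p ↦ X i p.1`. -/
def K3 (P : Measure Ω) (X : ℕ → Ω → Vec t) (f : ℕ → Vec t → Vec d → ℝ) (n : ℕ)
    (θ₀ : Vec d) : ℝ≥0∞ :=
  (12 * (n : ℝ≥0∞))⁻¹ * ∑ i ∈ Finset.range n,
    ∫⁻ p : Ω × Ω, (∑ m, ‖∑ l, invRootFisher P X f n θ₀ m l *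
      (score f i l (X i p.2) θ₀ - score f i l (X i p.1) θ₀)‖ₑ) ^ 3 ∂(P.prod P)

end Sampling

end MLEBound

end

/-! Write `Q = θhat - θ₀`, `B = avgFisher`, `A = B^{-1/2}`. The standardised estimator `√n B^{1/2}
Q` is compared with the standardised score `W = n^{-1/2} A ∇l_n(θ₀)`, and `W` with the standard
normal vector `Z`; the triangle inequality adds the two errors.

Estimator against score. Since `B^{1/2} = A B`, the difference of the two vectors is `n^{-1/2} A (n
B Q - ∇l_n(θ₀))`. On the event that every `|Q_j| < ε`, the likelihood equation `∇l_n(θhat) = 0`,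
expanded at `θ₀` with second-order remainder, bounds the bracket by the fluctuation of the Hessian
times `Q` plus a term quadratic in `Q` (`ae_abs_linearisation_le`). The `ℓ¹`-Lipschitz bound for `h`
and Cauchy-Schwarz give `K1`. Off the event the trivial bound `2‖h‖` is multiplied by `∑ Q_j² / ε² ≥
1`. This is `lintegral_enorm_standardized_sub_normScore_le`.

Score against normal. `W` is a sum of independent centred vectors `ξ_i`, whose covariances add up to
the identity by the information equality. Along the path `φ ↦ E h(sin φ W + cos φ Z)`, with `W` and
`Z` independent, Gaussian integration by parts turns the derivative into `cos φ` times the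
expectation of `W · ∇h - sin φ Δh` at the interpolated point. With `σ = sin φ`, each `ξ_i · ∇h` is
symmetrised against an independent copy `ξ_i'`. A first-order expansion of `∇h` about the unprimed
point replaces it by `σ/2 ∑ (C_i + ξ_i ξ_iᵀ)_{jk} ∂_k ∂_j h`, where `C_i` is the covariance of
`ξ_i`, up to a third-moment error (`enorm_integral_steinGap_le`). The second derivatives are taken
at the full interpolated point, which does not depend on `i`. Summing over `i` therefore produces `σ
Δh` exactly, plus a centred sum controlled by variances (`enorm_gradient_gap_le`). Integration in
`φ` gives the constants `1/4` and `1/12` (`enorm_integral_sum_sub_stdGaussian_le`). -/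

namespace MLEBound

/-! ### Taylor bounds, symmetry of second derivatives, and estimates for test functions. -/

section Calculus

variable {d : ℕ}

lemma fderiv_apply_eq_sum_pderiv (g : Vec d → ℝ) (x v : Vec d) :
    fderiv ℝ g x v = ∑ k, v k * pderiv k g x := by
  have hv : v = ∑ k, v k • EuclideanSpace.single k (1 : ℝ) := by
    ext i
    simp [Finset.sum_apply, Pi.single_apply]
  conv_lhs => rw [hv]
  simp [pderiv, map_sum]

lemma hasDerivAt_comp_segment {g : Vec d → ℝ} {u v : Vec d} {τ : ℝ}
    (hg : DifferentiableAt ℝ g (u + τ • v)) :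
    HasDerivAt (fun τ : ℝ => g (u + τ • v)) (∑ k, v k * pderiv k g (u + τ • v)) τ := by
  rw [← fderiv_apply_eq_sum_pderiv]
  have h1 : HasDerivAt (fun τ : ℝ => u + τ • v) v τ := by
    simpa using ((hasDerivAt_id τ).smul_const v).const_add u
  exact hg.hasFDerivAt.comp_hasDerivAt τ h1

/-- First-order Taylor expansion on `[0,1]` with a bound on the second derivative. -/
lemma abs_taylor_one_le {ψ ψ' ψ'' : ℝ → ℝ} {C : ℝ}
    (h1 : ∀ τ ∈ Set.Icc (0 : ℝ) 1, HasDerivAt ψ (ψ' τ) τ)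
    (h2 : ∀ τ ∈ Set.Icc (0 : ℝ) 1, HasDerivAt ψ' (ψ'' τ) τ)
    (hC : ∀ τ ∈ Set.Icc (0 : ℝ) 1, |ψ'' τ| ≤ C) :
    |ψ 1 - ψ 0 - ψ' 0| ≤ C / 2 := by
  have hψ' : ∀ τ ∈ Set.Icc (0 : ℝ) 1, |ψ' τ - ψ' 0| ≤ C * τ := by
    intro τ hτ
    -- The mean value inequality, used twice, replaces the integral remainder: `ψ''` is bounded but
    -- need not be continuous or integrable.
    have := image_norm_le_of_norm_deriv_right_le_deriv_boundary (a := (0 : ℝ)) (b := 1)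
      (f := fun τ => ψ' τ - ψ' 0) (f' := ψ'') (B := fun τ => C * τ) (B' := fun _ => C)
      (fun x hx => ((h2 x hx).sub_const _).continuousAt.continuousWithinAt)
      (fun x hx => ((h2 x (Set.Ico_subset_Icc_self hx)).sub_const _).hasDerivWithinAt)
      (by simp) (fun x => by simpa using (hasDerivAt_id x).const_mul C)
      (fun x hx => hC x (Set.Ico_subset_Icc_self hx)) hτ
    simpa using this
  have := image_norm_le_of_norm_deriv_right_le_deriv_boundary (a := (0 : ℝ)) (b := 1)
      (f := fun τ => ψ τ - ψ 0 - τ * ψ' 0) (f' := fun τ => ψ' τ - ψ' 0)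
      (B := fun τ => C * τ ^ 2 / 2) (B' := fun τ => C * τ)
      (fun x hx => (((h1 x hx).sub_const _).sub
        ((hasDerivAt_id x).mul_const (ψ' 0))).continuousAt.continuousWithinAt)
      (fun x hx => by
        have := (((h1 x (Set.Ico_subset_Icc_self hx)).sub_const (ψ 0)).fun_sub
          ((hasDerivAt_id x).mul_const (ψ' 0))).hasDerivWithinAt (s := Set.Ici x)
        simpa using this)
      (by simp) (fun x => by
        have := ((hasDerivAt_pow 2 x).const_mul C).div_const 2
        refine this.congr_deriv ?_
        simp; ring)
      (fun x hx => hψ' x (Set.Ico_subset_Icc_self hx)) (Set.right_mem_Icc.2 zero_le_one)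
  simpa using this

/-- First-order Taylor expansion along a segment with a bound on the second partial derivatives. -/
lemma abs_taylor_segment_le {g : Vec d → ℝ} {u v : Vec d} {C : ℝ}
    (h1 : ∀ τ ∈ Set.Icc (0 : ℝ) 1, DifferentiableAt ℝ g (u + τ • v))
    (h2 : ∀ τ ∈ Set.Icc (0 : ℝ) 1, ∀ k, DifferentiableAt ℝ (pderiv k g) (u + τ • v))
    (hC : ∀ τ ∈ Set.Icc (0 : ℝ) 1,
      ∑ k, ∑ l, |v k| * |v l| * |pderiv l (pderiv k g) (u + τ • v)| ≤ C) :
    |g (u + v) - g u - ∑ k, v k * pderiv k g u| ≤ C / 2 := by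
  have := abs_taylor_one_le (ψ := fun τ : ℝ => g (u + τ • v))
    (ψ' := fun τ => ∑ k, v k * pderiv k g (u + τ • v))
    (ψ'' := fun τ => ∑ k, v k * ∑ l, v l * pderiv l (pderiv k g) (u + τ • v)) (C := C)
    (fun τ hτ => hasDerivAt_comp_segment (h1 τ hτ))
    (fun τ hτ => HasDerivAt.fun_sum fun k _ =>
      (hasDerivAt_comp_segment (h2 τ hτ k)).const_mul (v k))
    (fun τ hτ => by
      refine le_trans ?_ (hC τ hτ)
      refine (Finset.abs_sum_le_sum_abs _ _).trans (Finset.sum_le_sum fun k _ => ?_)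
      rw [Finset.mul_sum]
      refine (Finset.abs_sum_le_sum_abs _ _).trans (Finset.sum_le_sum fun l _ => ?_)
      rw [abs_mul, abs_mul, mul_assoc])
  simpa using this

lemma pderiv_comp_affine {g : Vec d → ℝ} (hg : Differentiable ℝ g) (k : Fin d) (w : Vec d)
    (c : ℝ) (z : Vec d) :
    pderiv k (fun z => g (w + c • z)) z = c * pderiv k g (w + c • z) := by
  have h1 : HasFDerivAt (fun z : Vec d => w + c • z) (c • ContinuousLinearMap.id ℝ (Vec d)) z :=
    ((hasFDerivAt_id z).const_smul c).const_add w
  have := ((hg (w + c • z)).hasFDerivAt.comp z h1).fderiv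
  simp only [pderiv]
  rw [show (fun z => g (w + c • z)) = g ∘ fun z => w + c • z from rfl, this]
  simp

/-- Mixed second partial derivatives commute. -/
lemma pderiv_comm {g : Vec d → ℝ} {U : Set (Vec d)} (hU : IsOpen U) {x : Vec d} (hx : x ∈ U)
    (h1 : ∀ y ∈ U, DifferentiableAt ℝ g y)
    (h2 : ∀ k, DifferentiableAt ℝ (pderiv k g) x) (j k : Fin d) :
    pderiv j (pderiv k g) x = pderiv k (pderiv j g) x := by
  -- The gradient is a finite combination of the partials, so their differentiability at the single
  -- point `x` makes it Fréchet differentiable there; symmetry then needs no continuity of second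
  -- derivatives.
  have hfd : fderiv ℝ g = fun y => ∑ k, pderiv k g y • (EuclideanSpace.proj k : Vec d →L[ℝ] ℝ) := by
    funext y
    ext v
    rw [fderiv_apply_eq_sum_pderiv]
    simp [mul_comm]
  have hd : DifferentiableAt ℝ (fderiv ℝ g) x := by
    rw [hfd]
    exact DifferentiableAt.fun_sum fun k _ => (h2 k).smul_const _
  have hsymm := second_derivative_symmetric_of_eventually (f := g) (f' := fderiv ℝ g) (x := x)
    (Filter.eventually_of_mem (hU.mem_nhds hx) fun y hy => (h1 y hy).hasFDerivAt) hd.hasFDerivAt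
    (EuclideanSpace.single j 1) (EuclideanSpace.single k 1)
  have key : ∀ a b : Fin d, pderiv a (pderiv b g) x =
      fderiv ℝ (fderiv ℝ g) x (EuclideanSpace.single a 1) (EuclideanSpace.single b 1) := by
    intro a b
    have : HasFDerivAt (pderiv b g) ((fderiv ℝ (fderiv ℝ g) x).flip (EuclideanSpace.single b 1)) x :=
      (ContinuousLinearMap.apply ℝ ℝ (EuclideanSpace.single b 1 : Vec d)).hasFDerivAt.comp x
        hd.hasFDerivAt
    rw [pderiv, this.fderiv]
    rfl
  rw [key, key, hsymm]

lemma enorm_le_supNorm (h : Vec d → ℝ) (x : Vec d) : ‖h x‖ₑ ≤ supNorm h :=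
  le_iSup (fun x => ‖h x‖ₑ) x

lemma enorm_pderiv_le_supNorm1 (h : Vec d → ℝ) (i : Fin d) (x : Vec d) :
    ‖pderiv i h x‖ₑ ≤ supNorm1 h :=
  (enorm_le_supNorm _ x).trans (le_iSup (fun i => supNorm (pderiv i h)) i)

lemma enorm_pderiv_le_supNorm2 (h : Vec d → ℝ) (i j : Fin d) (x : Vec d) :
    ‖pderiv i (pderiv j h) x‖ₑ ≤ supNorm2 h :=
  (enorm_le_supNorm _ x).trans (le_iSup₂ (f := fun i j => supNorm (pderiv i (pderiv j h))) i j)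

lemma enorm_pderiv_le_supNorm3 (h : Vec d → ℝ) (i j k : Fin d) (x : Vec d) :
    ‖pderiv i (pderiv j (pderiv k h)) x‖ₑ ≤ supNorm3 h :=
  (enorm_le_supNorm _ x).trans (le_trans
    (le_iSup₂ (f := fun j k => supNorm (pderiv i (pderiv j (pderiv k h)))) j k)
    (le_iSup (fun i => ⨆ j, ⨆ k, supNorm (pderiv i (pderiv j (pderiv k h)))) i))

lemma abs_le_toReal_of_enorm_le {x : ℝ} {a : ℝ≥0∞} (hx : ‖x‖ₑ ≤ a) (ha : a < ∞) :
    |x| ≤ a.toReal := by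
  rw [← Real.norm_eq_abs, ← toReal_enorm]
  exact ENNReal.toReal_mono ha.ne hx

namespace IsTestFunction

variable {h : Vec d → ℝ} (hh : IsTestFunction h)
include hh

lemma abs_pderiv_le (i : Fin d) (x : Vec d) : |pderiv i h x| ≤ (supNorm1 h).toReal :=
  abs_le_toReal_of_enorm_le (enorm_pderiv_le_supNorm1 h i x) hh.bdd1

lemma abs_pderiv2_le (i j : Fin d) (x : Vec d) :
    |pderiv i (pderiv j h) x| ≤ (supNorm2 h).toReal :=
  abs_le_toReal_of_enorm_le (enorm_pderiv_le_supNorm2 h i j x) hh.bdd2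

lemma abs_pderiv3_le (i j k : Fin d) (x : Vec d) :
    |pderiv i (pderiv j (pderiv k h)) x| ≤ (supNorm3 h).toReal :=
  abs_le_toReal_of_enorm_le (enorm_pderiv_le_supNorm3 h i j k x) hh.bdd3

lemma abs_sub_le (u v : Vec d) :
    |h u - h v| ≤ (supNorm1 h).toReal * ∑ j, |u j - v j| := by
  have hder : ∀ τ ∈ Set.Icc (0 : ℝ) 1, HasDerivWithinAt (fun τ : ℝ => h (v + τ • (u - v)))
      (∑ k, (u - v) k * pderiv k h (v + τ • (u - v))) (Set.Icc 0 1) τ :=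
    fun τ _ => (hasDerivAt_comp_segment (hh.diff1 _)).hasDerivWithinAt
  have := norm_image_sub_le_of_norm_deriv_le_segment_01' hder
    (C := (supNorm1 h).toReal * ∑ j, |u j - v j|) (fun τ _ => by
      rw [Real.norm_eq_abs, Finset.mul_sum]
      refine (Finset.abs_sum_le_sum_abs _ _).trans (Finset.sum_le_sum fun k _ => ?_)
      rw [abs_mul, mul_comm]
      exact mul_le_mul_of_nonneg_right (hh.abs_pderiv_le k _) (abs_nonneg _))
  simpa using this

lemma enorm_sub_le (u v : Vec d) :
    ‖h u - h v‖ₑ ≤ supNorm1 h * ∑ j, ‖u j - v j‖ₑ := by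
  rw [Real.enorm_eq_ofReal_abs]
  refine (ENNReal.ofReal_le_ofReal (hh.abs_sub_le u v)).trans_eq ?_
  rw [ENNReal.ofReal_mul ENNReal.toReal_nonneg, ENNReal.ofReal_toReal hh.bdd1.ne,
    ENNReal.ofReal_sum_of_nonneg fun _ _ => abs_nonneg _]
  simp_rw [Real.enorm_eq_ofReal_abs]

lemma continuous : Continuous h := hh.diff1.continuous

lemma continuous_pderiv (i : Fin d) : Continuous (pderiv i h) := (hh.diff2 i).continuous

lemma continuous_pderiv2 (i j : Fin d) : Continuous (pderiv i (pderiv j h)) :=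
  (hh.diff3 i j).continuous

/-- Remainder of the first-order expansion of the gradient, summed against the increment. -/
lemma abs_grad_taylor_le (u v : Vec d) (j : Fin d) :
    |pderiv j h (u + v) - pderiv j h u - ∑ k, v k * pderiv k (pderiv j h) u|
      ≤ (supNorm3 h).toReal * (∑ k, |v k|) ^ 2 / 2 := by
  refine abs_taylor_segment_le (fun τ _ => hh.diff2 j _) (fun τ _ k => hh.diff3 k j _) ?_
  intro τ _
  rw [sq, Finset.sum_mul_sum, Finset.mul_sum]
  refine Finset.sum_le_sum fun k _ => ?_
  rw [Finset.mul_sum]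
  refine Finset.sum_le_sum fun l _ => ?_
  rw [mul_comm]
  exact mul_le_mul_of_nonneg_right (hh.abs_pderiv3_le l k j _) (by positivity)

end IsTestFunction

end Calculus

/-! ### Gaussian integration by parts. -/

section GaussianIntegrationByParts

lemma hasDerivAt_gaussianPDFReal_std (x : ℝ) :
    HasDerivAt (gaussianPDFReal 0 1) (-x * gaussianPDFReal 0 1 x) x := by
  have h1 : HasDerivAt (fun x : ℝ => -(x - 0) ^ 2 / (2 * ((1 : NNReal) : ℝ))) (-x) x := by
    have := (((hasDerivAt_id x).sub_const 0).fun_pow 2).fun_neg.div_const (2 * ((1 : NNReal) : ℝ))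
    refine this.congr_deriv ?_
    simp [neg_div]
  have h2 := h1.exp.const_mul (√(2 * Real.pi * ((1 : NNReal) : ℝ)))⁻¹
  rw [gaussianPDFReal_def]
  refine h2.congr_deriv ?_
  ring

lemma integrable_gaussianReal_std_iff {f : ℝ → ℝ} :
    Integrable f (gaussianReal 0 1) ↔ Integrable fun x => gaussianPDFReal 0 1 x * f x := by
  rw [gaussianReal_of_var_ne_zero 0 one_ne_zero,
    integrable_withDensity_iff_integrable_smul' (measurable_gaussianPDF 0 1)
      (Filter.Eventually.of_forall fun _ => gaussianPDF_lt_top)]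
  simp [toReal_gaussianPDF]

/-- Stein's identity for the standard normal law on the line. -/
lemma integral_id_mul_gaussianReal {g g' : ℝ → ℝ} {C : ℝ} (hg : ∀ x, HasDerivAt g (g' x) x)
    (hgC : ∀ x, |g x| ≤ C) (hg'C : ∀ x, |g' x| ≤ C) (hg' : Continuous g') :
    ∫ x, x * g x ∂(gaussianReal 0 1) = ∫ x, g' x ∂(gaussianReal 0 1) := by
  have hgc : Continuous g := continuous_iff_continuousAt.2 fun x => (hg x).continuousAt
  have hid : Integrable (fun x : ℝ => x) (gaussianReal 0 1) := IsGaussian.integrable_id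
  have i1 : Integrable g (gaussianReal 0 1) :=
    .of_bound hgc.aestronglyMeasurable C (.of_forall hgC)
  have i2 : Integrable g' (gaussianReal 0 1) :=
    .of_bound hg'.aestronglyMeasurable C (.of_forall hg'C)
  have i3 : Integrable (fun x => x * g x) (gaussianReal 0 1) :=
    hid.mul_bdd hgc.aestronglyMeasurable (.of_forall hgC)
  -- The density `p` satisfies `p' = -x p`, so `(p g)' = p (g' - x g)` has integral zero.
  have hzero := integral_eq_zero_of_hasDerivAt_of_integrable
    (f := fun x => gaussianPDFReal 0 1 x * g x)
    (f' := fun x => gaussianPDFReal 0 1 x * (g' x - x * g x))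
    (fun x => by
      refine ((hasDerivAt_gaussianPDFReal_std x).mul (hg x)).congr_deriv ?_
      ring)
    (integrable_gaussianReal_std_iff.1 (i2.sub i3)) (integrable_gaussianReal_std_iff.1 i1)
  have := integral_gaussianReal_eq_integral_smul (μ := 0) (v := 1) (f := fun x => g' x - x * g x)
    one_ne_zero
  simp only [smul_eq_mul, hzero] at this
  rw [integral_sub i2 i3] at this
  linarith

/-- Stein's identity for the standard normal law on `ℝ^d`, in one coordinate. -/
lemma integral_coord_mul_stdGaussian {d : ℕ} {g : Vec d → ℝ} {C : ℝ} (j : Fin d)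
    (hg : Differentiable ℝ g) (hgC : ∀ x, |g x| ≤ C) (hg'C : ∀ x, |pderiv j g x| ≤ C)
    (hg' : Continuous (pderiv j g)) :
    ∫ z, z j * g z ∂(stdGaussian (Vec d)) = ∫ z, pderiv j g z ∂(stdGaussian (Vec d)) := by
  obtain _ | m := d
  · exact j.elim0
  -- The coordinate `j` is split off by Fubini; the one-dimensional identity is then applied on each
  -- line parallel to the `j`-th axis.
  have hmp := (measurePreserving_piFinSuccAbove (α := fun _ : Fin (m + 1) => ℝ)
    (fun _ => gaussianReal 0 1) j).symm
  have hcont : Continuous fun p : ℝ × (Fin m → ℝ) =>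
      (WithLp.toLp 2 (j.insertNth (α := fun _ => ℝ) p.1 p.2) : Vec (m + 1)) :=
    (PiLp.continuous_toLp 2 _).comp (Continuous.finInsertNth j continuous_fst continuous_snd)
  have key : ∀ F : Vec (m + 1) → ℝ, Continuous F →
      ∫ z, F z ∂(stdGaussian (Vec (m + 1))) =
        ∫ p : ℝ × (Fin m → ℝ), F (WithLp.toLp 2 (j.insertNth (α := fun _ => ℝ) p.1 p.2))
          ∂((gaussianReal 0 1).prod (Measure.pi fun _ => gaussianReal 0 1)) := by
    intro F hF
    rw [← map_pi_eq_stdGaussian, integral_map (by fun_prop) hF.aestronglyMeasurable,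
      ← hmp.map_eq, integral_map_equiv]
    rfl
  have hseg : ∀ (x : ℝ) (y : Fin m → ℝ),
      (WithLp.toLp 2 (j.insertNth (α := fun _ => ℝ) x y) : Vec (m + 1)) =
        WithLp.toLp 2 (j.insertNth (α := fun _ => ℝ) 0 y) + x • EuclideanSpace.single j 1 := by
    intro x y
    ext i
    refine j.succAboveCases ?_ (fun i => ?_) i <;> simp
  have hder : ∀ (y : Fin m → ℝ) (x : ℝ),
      HasDerivAt (fun x => g (WithLp.toLp 2 (j.insertNth (α := fun _ => ℝ) x y)))
        (pderiv j g (WithLp.toLp 2 (j.insertNth (α := fun _ => ℝ) x y))) x := by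
    intro y x
    have := hasDerivAt_comp_segment (g := g)
      (u := WithLp.toLp 2 (j.insertNth (α := fun _ => ℝ) 0 y))
      (v := EuclideanSpace.single j 1) (τ := x) (hg _)
    simp only [← hseg] at this
    simpa [Pi.single_apply] using this
  have hid : Integrable (fun x : ℝ => x) (gaussianReal 0 1) := IsGaussian.integrable_id
  have hjc : Continuous fun z : Vec (m + 1) => z j := by fun_prop
  rw [key (fun z => z j * g z) (hjc.mul hg.continuous), key _ hg', integral_prod_symm, integral_prod_symm]
  · refine integral_congr_ae (.of_forall fun y => ?_)
    simp only [Fin.insertNth_apply_same]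
    exact integral_id_mul_gaussianReal (hder y) (fun _ => hgC _) (fun _ => hg'C _)
      (hg'.comp (hcont.comp (Continuous.prodMk_left y)))
  · exact .of_bound (hg'.comp hcont).aestronglyMeasurable C (.of_forall fun _ => hg'C _)
  · simp only [Fin.insertNth_apply_same]
    exact (hid.comp_fst _).mul_bdd (hg.continuous.comp hcont).aestronglyMeasurable
      (.of_forall fun _ => hgC _)

/-- Stein's identity along an affine image of the standard normal law. -/
lemma integral_coord_mul_affine_stdGaussian {d : ℕ} {g : Vec d → ℝ} {C C' : ℝ} (j : Fin d)
    (hg : Differentiable ℝ g) (hgC : ∀ x, |g x| ≤ C) (hg'C : ∀ x, |pderiv j g x| ≤ C')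
    (hg' : Continuous (pderiv j g)) (w : Vec d) (c : ℝ) :
    ∫ z, z j * g (w + c • z) ∂(stdGaussian (Vec d)) =
      c * ∫ z, pderiv j g (w + c • z) ∂(stdGaussian (Vec d)) := by
  have hp : pderiv j (fun z => g (w + c • z)) = fun z => c * pderiv j g (w + c • z) :=
    funext (pderiv_comp_affine hg j w c)
  rw [← integral_const_mul, ← hp]
  refine integral_coord_mul_stdGaussian (C := max C (|c| * C')) j
    (hg.comp (by fun_prop)) (fun _ => le_max_of_le_left (hgC _)) (fun z => ?_) ?_
  · rw [hp, abs_mul]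
    exact le_max_of_le_right (mul_le_mul_of_nonneg_left (hg'C _) (abs_nonneg _))
  · rw [hp]
    fun_prop

end GaussianIntegrationByParts

/-! ### Symmetrisation with an independent copy. -/

section IndependentCopy

variable {Ω : Type*} [MeasurableSpace Ω] {P : Measure Ω} [IsProbabilityMeasure P]

/-- After expansion, the two mixed terms factor over the product measure and vanish because `a` is
centred; the two diagonal terms agree. -/
lemma hasIntegral_sub_mul_sub {a G : Ω → ℝ} (ha : Integrable a P) (ha0 : ∫ ω, a ω ∂P = 0)
    (hG : Integrable G P) (haG : Integrable (fun ω => a ω * G ω) P) :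
    Integrable (fun p : Ω × Ω => (a p.2 - a p.1) * (G p.2 - G p.1)) (P.prod P) ∧
      ∫ p : Ω × Ω, (a p.2 - a p.1) * (G p.2 - G p.1) ∂(P.prod P) = 2 * ∫ ω, a ω * G ω ∂P := by
  have one : Integrable (fun _ : Ω => (1 : ℝ)) P := integrable_const 1
  have i1 := one.mul_prod (ν := P) haG
  have i2 := hG.mul_prod (ν := P) ha
  have i3 := ha.mul_prod (ν := P) hG
  have i4 := haG.mul_prod (ν := P) one
  have e : (fun p : Ω × Ω => (a p.2 - a p.1) * (G p.2 - G p.1)) = fun p =>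
      (1 * (a p.2 * G p.2) - G p.1 * a p.2 - a p.1 * G p.2) + (a p.1 * G p.1) * 1 := by
    funext p; ring
  rw [e]
  have i12 : Integrable (fun p : Ω × Ω => 1 * (a p.2 * G p.2) - G p.1 * a p.2) (P.prod P) :=
    i1.sub i2
  have i123 : Integrable (fun p : Ω × Ω => 1 * (a p.2 * G p.2) - G p.1 * a p.2 - a p.1 * G p.2)
    (P.prod P) := i12.sub i3
  refine ⟨i123.add i4, ?_⟩
  rw [integral_add i123 i4, integral_sub i12 i3, integral_sub i1 i2,
    integral_prod_mul (fun _ => (1 : ℝ)) (fun ω => a ω * G ω), integral_prod_mul G a,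
    integral_prod_mul a G, integral_prod_mul (fun ω => a ω * G ω) (fun _ => (1 : ℝ)), ha0]
  simp
  ring

/-- Since `H` sees only the first copy, the second copy can be integrated out; centring kills the
mixed terms and leaves `E[ab] + ab`. This is the origin of the weight `C j k + x j * x k` in
`steinGap`. -/
lemma hasIntegral_sub_mul_sub_mul {a b H : Ω → ℝ} (ha : Integrable a P)
    (ha0 : ∫ ω, a ω ∂P = 0) (hb : Integrable b P) (hb0 : ∫ ω, b ω ∂P = 0)
    (hab : Integrable (fun ω => a ω * b ω) P) {c : ℝ} (hH : AEStronglyMeasurable H P)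
    (hHc : ∀ ω, |H ω| ≤ c) :
    Integrable (fun p : Ω × Ω => (a p.2 - a p.1) * (b p.2 - b p.1) * H p.1) (P.prod P) ∧
      ∫ p : Ω × Ω, (a p.2 - a p.1) * (b p.2 - b p.1) * H p.1 ∂(P.prod P) =
        ∫ ω, (∫ ω', a ω' * b ω' ∂P + a ω * b ω) * H ω ∂P := by
  have one : Integrable (fun _ : Ω => (1 : ℝ)) P := integrable_const 1
  have hHi : Integrable H P := .of_bound hH c (.of_forall hHc)
  have haH : Integrable (fun ω => a ω * H ω) P := ha.mul_bdd hH (.of_forall hHc)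
  have hbH : Integrable (fun ω => b ω * H ω) P := hb.mul_bdd hH (.of_forall hHc)
  have habH : Integrable (fun ω => a ω * b ω * H ω) P := hab.mul_bdd hH (.of_forall hHc)
  have i1 := hHi.mul_prod (ν := P) hab
  have i2 := hbH.mul_prod (ν := P) ha
  have i3 := haH.mul_prod (ν := P) hb
  have i4 := habH.mul_prod (ν := P) one
  have e : (fun p : Ω × Ω => (a p.2 - a p.1) * (b p.2 - b p.1) * H p.1) = fun p =>
      (H p.1 * (a p.2 * b p.2) - b p.1 * H p.1 * a p.2 - a p.1 * H p.1 * b p.2)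
        + (a p.1 * b p.1 * H p.1) * 1 := by
    funext p; ring
  rw [e]
  have i12 : Integrable (fun p : Ω × Ω => H p.1 * (a p.2 * b p.2) - b p.1 * H p.1 * a p.2)
    (P.prod P) := i1.sub i2
  have i123 : Integrable (fun p : Ω × Ω => H p.1 * (a p.2 * b p.2) - b p.1 * H p.1 * a p.2
    - a p.1 * H p.1 * b p.2) (P.prod P) := i12.sub i3
  refine ⟨i123.add i4, ?_⟩
  rw [integral_add i123 i4, integral_sub i12 i3, integral_sub i1 i2,
    integral_prod_mul H (fun ω => a ω * b ω), integral_prod_mul (fun ω => b ω * H ω) a,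
    integral_prod_mul (fun ω => a ω * H ω) b,
    integral_prod_mul (fun ω => a ω * b ω * H ω) (fun _ => (1 : ℝ)), ha0, hb0]
  simp_rw [add_mul]
  rw [integral_add (hHi.const_mul _) habH, integral_const_mul]
  simp
  ring

end IndependentCopy

/-! ### Contribution of a single summand. -/

section Summand

variable {d : ℕ} {Ω : Type*} [MeasurableSpace Ω] {P : Measure Ω} [IsProbabilityMeasure P]

/-- The discrepancy in the second-order expansion of `x ↦ x · ∇h(s x + r)`, for a centred random
vector `x` with covariance matrix `C`. -/
noncomputable def steinGap (h : Vec d → ℝ) (C : Fin d → Fin d → ℝ) (s : ℝ) (x r : Vec d) : ℝ :=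
  ∑ j, x j * pderiv j h (s • x + r) -
    s / 2 * ∑ j, ∑ k, (C j k + x j * x k) * pderiv k (pderiv j h) (s • x + r)

lemma continuous_steinGap {h : Vec d → ℝ} (hh : IsTestFunction h) (C : Fin d → Fin d → ℝ) (s : ℝ) :
    Continuous fun p : Vec d × Vec d => steinGap h C s p.1 p.2 := by
  have h1 := hh.continuous_pderiv
  have h2 := hh.continuous_pderiv2
  unfold steinGap
  fun_prop

variable {η : Ω → Vec d} (hη : Measurable η) (hη2 : ∀ j, MemLp (fun ω => η ω j) 2 P)

include hη2 in
lemma integrable_coord (j : Fin d) : Integrable (fun ω => η ω j) P :=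
  (hη2 j).integrable one_le_two

omit [IsProbabilityMeasure P] in
include hη2 in
lemma integrable_coord_mul_coord (j k : Fin d) : Integrable (fun ω => η ω j * η ω k) P :=
  (hη2 j).integrable_mul (hη2 k)

include hη2 in
lemma integrable_coord_mul_pderiv {h : Vec d → ℝ} (hh : IsTestFunction h) {Y : Ω → Vec d}
    (hY : Measurable Y) (i j : Fin d) : Integrable (fun ω => η ω j * pderiv i h (Y ω)) P :=
  (integrable_coord hη2 j).mul_bdd
    ((hh.continuous_pderiv i).measurable.comp hY).aestronglyMeasurable
    (.of_forall fun _ => hh.abs_pderiv_le i _)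

omit [IsProbabilityMeasure P] in
lemma integrable_mul_pderiv2 {f : Ω → ℝ} (hf : Integrable f P) {h : Vec d → ℝ}
    (hh : IsTestFunction h) {Y : Ω → Vec d} (hY : Measurable Y) (i j : Fin d) :
    Integrable (fun ω => f ω * pderiv i (pderiv j h) (Y ω)) P :=
  hf.mul_bdd ((hh.continuous_pderiv2 i j).measurable.comp hY).aestronglyMeasurable
    (.of_forall fun _ => hh.abs_pderiv2_le i j _)

include hη2 in
lemma integrable_cov_mul_pderiv2 {h : Vec d → ℝ} (hh : IsTestFunction h) (c : ℝ)
    {Y : Ω → Vec d} (hY : Measurable Y) (j k : Fin d) :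
    Integrable (fun ω => (c + η ω j * η ω k) * pderiv k (pderiv j h) (Y ω)) P :=
  integrable_mul_pderiv2 (f := fun ω => c + η ω j * η ω k)
    ((integrable_const c).add (integrable_coord_mul_coord hη2 j k)) hh hY k j

include hη hη2 in
lemma hasIntegral_steinGap {h : Vec d → ℝ} (hh : IsTestFunction h) (C : Fin d → Fin d → ℝ) (s : ℝ)
    {R : Ω → Vec d} (hR : Measurable R) :
    Integrable (fun ω => steinGap h C s (η ω) (R ω)) P ∧
      ∫ ω, steinGap h C s (η ω) (R ω) ∂P =
        ∑ j, ∫ ω, η ω j * pderiv j h (s • η ω + R ω) ∂P - s / 2 * ∑ j, ∑ k,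
          ∫ ω, (C j k + η ω j * η ω k) * pderiv k (pderiv j h) (s • η ω + R ω) ∂P := by
  have hY : Measurable fun ω => s • η ω + R ω := by fun_prop
  have i1 := integrable_finsetSum Finset.univ fun j _ => integrable_coord_mul_pderiv hη2 hh hY j j
  have i2 := fun j => integrable_finsetSum Finset.univ fun k _ =>
    integrable_cov_mul_pderiv2 hη2 hh (C j k) hY j k
  have i3 := (integrable_finsetSum Finset.univ fun j _ => i2 j).const_mul (s / 2)
  unfold steinGap
  refine ⟨i1.sub i3, ?_⟩
  rw [integral_sub i1 i3, integral_const_mul, integral_finsetSum _ fun j _ => i2 j,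
    integral_finsetSum _ fun j _ => integrable_coord_mul_pderiv hη2 hh hY j j]
  congr 2
  exact Finset.sum_congr rfl fun j _ => integral_finsetSum _ fun k _ =>
    integrable_cov_mul_pderiv2 hη2 hh (C j k) hY j k

include hη hη2 in
-- By the two symmetrisation identities, the expected gap is half the expectation of `η' - η` paired
-- with the first-order Taylor remainder of `∇h` between the points built from `η` and `η'`. That
-- remainder is quadratic in the increment, which makes the bound cubic.
lemma enorm_integral_steinGap_le (hη0 : ∀ j, ∫ ω, η ω j ∂P = 0) {h : Vec d → ℝ}
    (hh : IsTestFunction h) (s : ℝ) (r : Vec d) :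
    ‖∫ ω, steinGap h (fun j k => ∫ ω, η ω j * η ω k ∂P) s (η ω) r ∂P‖ₑ ≤
      ENNReal.ofReal (s ^ 2 / 4) * supNorm3 h *
        ∫⁻ p : Ω × Ω, (∑ m, ‖η p.2 m - η p.1 m‖ₑ) ^ 3 ∂(P.prod P) := by
  set Y : Ω → Vec d := fun ω => s • η ω + r with hYdef
  have hY : Measurable Y := by fun_prop
  have hA := fun j => hasIntegral_sub_mul_sub (a := fun ω => η ω j)
    (G := fun ω => pderiv j h (Y ω)) (integrable_coord hη2 j) (hη0 j)
    (.of_bound ((hh.continuous_pderiv j).measurable.comp hY).aestronglyMeasurable _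
      (.of_forall fun _ => hh.abs_pderiv_le j _)) (integrable_coord_mul_pderiv hη2 hh hY j j)
  have hB := fun j k => hasIntegral_sub_mul_sub_mul (a := fun ω => η ω j) (b := fun ω => η ω k)
    (H := fun ω => pderiv k (pderiv j h) (Y ω))
    (integrable_coord hη2 j) (hη0 j) (integrable_coord hη2 k) (hη0 k)
    (integrable_coord_mul_coord hη2 j k)
    ((hh.continuous_pderiv2 k j).measurable.comp hY).aestronglyMeasurable
    (fun _ => hh.abs_pderiv2_le k j _)
  have key : ∫ ω, steinGap h (fun j k => ∫ ω, η ω j * η ω k ∂P) s (η ω) r ∂P =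
      ∫ p : Ω × Ω, 1 / 2 * ∑ j, (η p.2 j - η p.1 j) *
        (pderiv j h (Y p.2) - pderiv j h (Y p.1)
          - ∑ k, (s * (η p.2 k - η p.1 k)) * pderiv k (pderiv j h) (Y p.1)) ∂(P.prod P) := by
    have e : ∀ p : Ω × Ω, 1 / 2 * ∑ j, (η p.2 j - η p.1 j) *
        (pderiv j h (Y p.2) - pderiv j h (Y p.1)
          - ∑ k, (s * (η p.2 k - η p.1 k)) * pderiv k (pderiv j h) (Y p.1)) =
        1 / 2 * (∑ j, (η p.2 j - η p.1 j) * (pderiv j h (Y p.2) - pderiv j h (Y p.1)) -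
          s * ∑ j, ∑ k, (η p.2 j - η p.1 j) * (η p.2 k - η p.1 k)
            * pderiv k (pderiv j h) (Y p.1)) := by
      intro p
      rw [Finset.mul_sum (s := Finset.univ) (a := s), ← Finset.sum_sub_distrib]
      congr 1
      refine Finset.sum_congr rfl fun j _ => ?_
      rw [mul_sub, Finset.mul_sum, Finset.mul_sum]
      congr 1
      exact Finset.sum_congr rfl fun k _ => by ring
    have i1 := integrable_finsetSum Finset.univ fun j _ => (hA j).1
    have i2 := fun j => integrable_finsetSum Finset.univ fun k _ => (hB j k).1
    have i3 := (integrable_finsetSum Finset.univ fun j _ => i2 j).const_mul s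
    rw [(hasIntegral_steinGap hη hη2 hh _ s measurable_const).2]
    simp_rw [e]
    rw [integral_const_mul, integral_sub i1 i3, integral_const_mul,
      integral_finsetSum _ fun j _ => (hA j).1, integral_finsetSum _ fun j _ => i2 j]
    simp_rw [(hA _).2]
    rw [← Finset.mul_sum, Finset.sum_congr rfl fun j _ => integral_finsetSum _ fun k _ => (hB j k).1]
    simp_rw [(hB _ _).2]
    ring
  rw [key]
  refine (enorm_integral_le_lintegral_enorm _).trans ?_
  rw [← lintegral_const_mul' _ _ (ENNReal.mul_ne_top ENNReal.ofReal_ne_top hh.bdd3.ne)]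
  refine lintegral_mono fun p => ?_
  have hΔ : ∀ j, |pderiv j h (Y p.2) - pderiv j h (Y p.1)
      - ∑ k, (s * (η p.2 k - η p.1 k)) * pderiv k (pderiv j h) (Y p.1)| ≤
      (supNorm3 h).toReal * (s ^ 2 * (∑ k, |η p.2 k - η p.1 k|) ^ 2) / 2 := by
    intro j
    have := hh.abs_grad_taylor_le (Y p.1) (s • (η p.2 - η p.1)) j
    have e : Y p.1 + s • (η p.2 - η p.1) = Y p.2 := by
      simp only [hYdef, smul_sub]; abel
    rw [e] at this
    simp only [PiLp.smul_apply, PiLp.sub_apply, smul_eq_mul, abs_mul, ← Finset.mul_sum,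
      mul_pow, sq_abs] at this
    exact this
  have hreal : |1 / 2 * ∑ j, (η p.2 j - η p.1 j) *
        (pderiv j h (Y p.2) - pderiv j h (Y p.1)
          - ∑ k, (s * (η p.2 k - η p.1 k)) * pderiv k (pderiv j h) (Y p.1))| ≤
      s ^ 2 / 4 * (supNorm3 h).toReal * (∑ k, |η p.2 k - η p.1 k|) ^ 3 := by
    rw [abs_mul, abs_of_nonneg (by norm_num : (0 : ℝ) ≤ 1 / 2)]
    -- The factor `1/4` is `1/2` from symmetrisation times `1/2` from Taylor.
    calc _ ≤ 1 / 2 * ∑ j, |η p.2 j - η p.1 j| *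
          ((supNorm3 h).toReal * (s ^ 2 * (∑ k, |η p.2 k - η p.1 k|) ^ 2) / 2) := by
          gcongr
          refine (Finset.abs_sum_le_sum_abs _ _).trans (Finset.sum_le_sum fun j _ => ?_)
          rw [abs_mul]
          exact mul_le_mul_of_nonneg_left (hΔ j) (abs_nonneg _)
      _ = _ := by rw [← Finset.sum_mul]; ring
  rw [Real.enorm_eq_ofReal_abs]
  refine (ENNReal.ofReal_le_ofReal hreal).trans_eq ?_
  rw [ENNReal.ofReal_mul (by positivity), ENNReal.ofReal_mul (by positivity),
    ENNReal.ofReal_toReal hh.bdd3.ne, ENNReal.ofReal_pow (by positivity),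
    ENNReal.ofReal_sum_of_nonneg fun _ _ => abs_nonneg _]
  simp_rw [Real.enorm_eq_ofReal_abs]

include hη hη2 in
/-- The bound of `enorm_integral_steinGap_le` with a random shift independent of the summand. -/
lemma enorm_integral_steinGap_indep_le (hη0 : ∀ j, ∫ ω, η ω j ∂P = 0) {h : Vec d → ℝ}
    (hh : IsTestFunction h) (s : ℝ) {R : Ω → Vec d} (hR : Measurable R) (hηR : IndepFun η R P) :
    ‖∫ ω, steinGap h (fun j k => ∫ ω, η ω j * η ω k ∂P) s (η ω) (R ω) ∂P‖ₑ ≤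
      ENNReal.ofReal (s ^ 2 / 4) * supNorm3 h *
        ∫⁻ p : Ω × Ω, (∑ m, ‖η p.2 m - η p.1 m‖ₑ) ^ 3 ∂(P.prod P) := by
  set C : Fin d → Fin d → ℝ := fun j k => ∫ ω, η ω j * η ω k ∂P
  have hc := continuous_steinGap hh C s
  have hlaw := (indepFun_iff_map_prod_eq_prod_map_map hη.aemeasurable hR.aemeasurable).1 hηR
  have := Measure.isProbabilityMeasure_map (μ := P) hη.aemeasurable
  have := Measure.isProbabilityMeasure_map (μ := P) hR.aemeasurable
  have hint : Integrable (fun p : Vec d × Vec d => steinGap h C s p.1 p.2)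
      ((P.map η).prod (P.map R)) := by
    rw [← hlaw, integrable_map_measure hc.aestronglyMeasurable (by fun_prop)]
    exact (hasIntegral_steinGap hη hη2 hh C s hR).1
  -- By independence the joint law is a product, so Fubini freezes the shift at a value `r`; the
  -- bound for constant shifts is uniform in `r`.
  have e : ∫ ω, steinGap h C s (η ω) (R ω) ∂P =
      ∫ r, ∫ ω, steinGap h C s (η ω) r ∂P ∂(P.map R) := by
    rw [← integral_map (φ := fun ω => (η ω, R ω)) (f := fun p => steinGap h C s p.1 p.2)
      (by fun_prop) hc.aestronglyMeasurable, hlaw, integral_prod_symm _ hint]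
    refine integral_congr_ae (.of_forall fun r => ?_)
    exact integral_map hη.aemeasurable
      (hc.comp (Continuous.prodMk_left r)).aestronglyMeasurable
  rw [e]
  refine (enorm_integral_le_lintegral_enorm _).trans ?_
  refine (lintegral_mono fun r => enorm_integral_steinGap_le hη hη2 hη0 hh s r).trans ?_
  simp

end Summand

/-! ### Square roots in `[0,∞]`, Cauchy-Schwarz and variances of sums. -/

lemma esqrt_top : esqrt ∞ = ∞ := by simp [esqrt]

lemma esqrt_mono {a b : ℝ≥0∞} (hab : a ≤ b) : esqrt a ≤ esqrt b :=
  ENNReal.rpow_le_rpow hab (by norm_num)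

lemma esqrt_mul (a b : ℝ≥0∞) : esqrt (a * b) = esqrt a * esqrt b :=
  ENNReal.mul_rpow_of_nonneg _ _ (by norm_num)

lemma esqrt_sq (a : ℝ≥0∞) : esqrt (a ^ 2) = a := by
  rw [esqrt, ← ENNReal.rpow_natCast, ← ENNReal.rpow_mul]
  norm_num

lemma esqrt_mul_self (a : ℝ≥0∞) : esqrt a * esqrt a = a := by
  rw [← esqrt_mul, ← sq, esqrt_sq]

section SecondMoment

variable {Ω : Type*} [MeasurableSpace Ω]

/-- The Cauchy-Schwarz inequality. -/
lemma lintegral_mul_le_esqrt (μ : Measure Ω) {f g : Ω → ℝ≥0∞} (hf : AEMeasurable f μ)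
    (hg : AEMeasurable g μ) :
    ∫⁻ ω, f ω * g ω ∂μ ≤ esqrt (∫⁻ ω, f ω ^ 2 ∂μ) * esqrt (∫⁻ ω, g ω ^ 2 ∂μ) := by
  have := ENNReal.lintegral_mul_le_Lp_mul_Lq μ (Real.holderConjugate_iff.2 ⟨one_lt_two, by norm_num⟩
    : (2 : ℝ).HolderConjugate 2) hf hg
  simpa only [esqrt, Pi.mul_apply, ENNReal.rpow_two] using this

lemma lintegral_le_esqrt (P : Measure Ω) [IsProbabilityMeasure P] {f : Ω → ℝ≥0∞}
    (hf : AEMeasurable f P) : ∫⁻ ω, f ω ∂P ≤ esqrt (∫⁻ ω, f ω ^ 2 ∂P) := by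
  simpa [esqrt] using lintegral_mul_le_esqrt P hf (aemeasurable_const (b := (1 : ℝ≥0∞)))

lemma lintegral_enorm_sum_sub_mean_le {P : Measure Ω} [IsProbabilityMeasure P] {ι : Type*}
    (s : Finset ι) {Y : ι → Ω → ℝ} (hY : ∀ i, Integrable (Y i) P) (hind : iIndepFun Y P) :
    ∫⁻ ω, ‖∑ i ∈ s, (Y i ω - ∫ ω', Y i ω' ∂P)‖ₑ ∂P ≤ esqrt (∑ i ∈ s, evariance (Y i) P) := by
  -- An infinite variance makes the bound trivial; otherwise all terms are in `L²`, variances add by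
  -- independence, and the `L¹` norm is at most the `L²` norm.
  by_cases htop : ∃ i ∈ s, evariance (Y i) P = ∞
  · obtain ⟨i, hi, h⟩ := htop
    rw [ENNReal.sum_eq_top.2 ⟨i, hi, h⟩, esqrt_top]
    exact le_top
  push Not at htop
  have hL : ∀ i ∈ s, MemLp (Y i) 2 P := fun i hi =>
    (evariance_lt_top_iff_memLp (hY i).aestronglyMeasurable).1 (lt_top_iff_ne_top.2 (htop i hi))
  have hS : MemLp (∑ i ∈ s, Y i) 2 P := by
    have := memLp_finsetSum s hL
    convert this using 1
    ext; simp
  have hvar : evariance (∑ i ∈ s, Y i) P = ∑ i ∈ s, evariance (Y i) P := by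
    rw [← hS.ofReal_variance_eq,
      IndepFun.variance_sum hL fun i _ j _ hij => hind.indepFun hij,
      ENNReal.ofReal_sum_of_nonneg fun _ _ => variance_nonneg _ _]
    exact Finset.sum_congr rfl fun i hi => (hL i hi).ofReal_variance_eq
  have e : ∀ ω, ∑ i ∈ s, (Y i ω - ∫ ω', Y i ω' ∂P) =
      (∑ i ∈ s, Y i) ω - ∫ ω', (∑ i ∈ s, Y i) ω' ∂P := by
    intro ω
    simp only [Finset.sum_apply]
    rw [integral_finsetSum _ fun i _ => hY i, Finset.sum_sub_distrib]
  rw [← hvar]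
  simp_rw [e]
  exact lintegral_le_esqrt P
    (hS.aestronglyMeasurable.sub aestronglyMeasurable_const).enorm

end SecondMoment

/-! ### The Stein identity for a sum, up to variance and third-moment errors. -/

section NormalApproximation

variable {d : ℕ} {Ω : Type*} [MeasurableSpace Ω] {P : Measure Ω} [IsProbabilityMeasure P]
  {ι : Type*} {s : Finset ι} {ξ : ι → Ω → Vec d}

/-- For a sum of independent summands, `∑ W_j ∂_j h` nearly equals `σ Δh` in expectation. This is
the integrand left in the derivative of `smartPath` after the normal vector is fixed, with `r`
standing for its contribution. -/
lemma enorm_gradient_gap_le (hξ : ∀ i, Measurable (ξ i)) (hind : iIndepFun ξ P)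
    (hξ2 : ∀ i j, MemLp (fun ω => ξ i ω j) 2 P) (hξ0 : ∀ i j, ∫ ω, ξ i ω j ∂P = 0)
    (hcov : ∀ j k, ∑ i ∈ s, ∫ ω, ξ i ω j * ξ i ω k ∂P = if j = k then 1 else 0)
    {h : Vec d → ℝ} (hh : IsTestFunction h) {σ : ℝ} (hσ : 0 ≤ σ) (r : Vec d) :
    ‖∑ j, ∫ ω, (∑ i ∈ s, ξ i ω) j * pderiv j h (σ • ∑ i ∈ s, ξ i ω + r) ∂P -
        σ * ∑ j, ∫ ω, pderiv j (pderiv j h) (σ • ∑ i ∈ s, ξ i ω + r) ∂P‖ₑ ≤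
      ENNReal.ofReal (σ / 2) * (supNorm2 h *
        ∑ j, ∑ k, esqrt (∑ i ∈ s, evariance (fun ω => ξ i ω j * ξ i ω k) P)) +
      ENNReal.ofReal (σ ^ 2 / 4) * (supNorm3 h *
        ∑ i ∈ s, ∫⁻ p : Ω × Ω, (∑ m, ‖ξ i p.2 m - ξ i p.1 m‖ₑ) ^ 3 ∂(P.prod P)) := by
  classical
  set Y : Ω → Vec d := fun ω => σ • ∑ i ∈ s, ξ i ω + r with hYdef
  have hY : Measurable Y := by fun_prop
  set C : ι → Fin d → Fin d → ℝ := fun i j k => ∫ ω, ξ i ω j * ξ i ω k ∂P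
  -- Leaving out the `i`-th summand gives a shift independent of `ξ i`, while `σ • ξ i + R i` is the
  -- same point `Y` for every `i`.
  set R : ι → Ω → Vec d := fun i ω => σ • ∑ l ∈ s.erase i, ξ l ω + r
  have hR : ∀ i, Measurable (R i) := fun i => by fun_prop
  have hYR : ∀ i ∈ s, ∀ ω, σ • ξ i ω + R i ω = Y ω := by
    intro i hi ω
    simp only [R, hYdef]
    rw [← Finset.add_sum_erase s (fun i => ξ i ω) hi, smul_add, add_assoc]
  have hindR : ∀ i, IndepFun (ξ i) (R i) P := by
    intro i
    have h1 := (hind.indepFun_finsetSum_of_notMem hξ (Finset.notMem_erase i s)).symm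
    have h2 := h1.comp measurable_id (show Measurable fun x : Vec d => σ • x + r by fun_prop)
    have e : R i = (fun x => σ • x + r) ∘ ∑ j ∈ s.erase i, ξ j := by
      funext ω
      simp [R]
    rw [e]
    exact h2
  have hcovint : ∀ i j k, Integrable (fun ω => ξ i ω j * ξ i ω k) P := fun i j k =>
    integrable_coord_mul_coord (hξ2 i) j k
  have hgap : ∀ i ∈ s, ∫ ω, steinGap h (C i) σ (ξ i ω) (R i ω) ∂P =
      ∑ j, ∫ ω, ξ i ω j * pderiv j h (Y ω) ∂P -
        σ / 2 * ∑ j, ∑ k, ∫ ω, (C i j k + ξ i ω j * ξ i ω k) * pderiv k (pderiv j h) (Y ω) ∂P := by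
    intro i hi
    rw [(hasIntegral_steinGap (hξ i) (hξ2 i) hh (C i) σ (hR i)).2]
    simp_rw [hYR i hi]
  have h1 : ∀ j, ∫ ω, (∑ i ∈ s, ξ i ω) j * pderiv j h (Y ω) ∂P =
      ∑ i ∈ s, ∫ ω, ξ i ω j * pderiv j h (Y ω) ∂P := by
    intro j
    rw [← integral_finsetSum _ fun i _ => integrable_coord_mul_pderiv (hξ2 i) hh hY j j]
    simp_rw [← Finset.sum_mul]
    simp
  -- Since `C + ξξᵀ = 2C + (ξξᵀ - C)` and the `C i` sum to the identity, the factor `2` cancels the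
  -- `1/2` of `steinGap` and only a centred sum remains as error.
  have h2 : ∀ j k, ∑ i ∈ s, ∫ ω, (C i j k + ξ i ω j * ξ i ω k) * pderiv k (pderiv j h) (Y ω) ∂P =
      2 * ((if j = k then 1 else 0) * ∫ ω, pderiv k (pderiv j h) (Y ω) ∂P) +
        ∫ ω, (∑ i ∈ s, (ξ i ω j * ξ i ω k - C i j k)) * pderiv k (pderiv j h) (Y ω) ∂P := by
    intro j k
    have i1 : Integrable (fun ω => pderiv k (pderiv j h) (Y ω)) P := by
      simpa using integrable_mul_pderiv2 (integrable_const (1 : ℝ)) hh hY k j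
    have i2 : Integrable (fun ω => (∑ i ∈ s, (ξ i ω j * ξ i ω k - C i j k)) *
        pderiv k (pderiv j h) (Y ω)) P :=
      integrable_mul_pderiv2 (integrable_finsetSum _ fun i _ =>
        (hcovint i j k).sub (integrable_const _)) hh hY k j
    rw [← integral_finsetSum _ fun i _ => integrable_cov_mul_pderiv2 (hξ2 i) hh (C i j k) hY j k,
      ← hcov j k, ← mul_assoc, ← integral_const_mul, ← integral_add (i1.const_mul _) i2]
    refine integral_congr_ae (.of_forall fun ω => ?_)
    simp only []
    rw [← Finset.sum_mul, ← add_mul, Finset.sum_add_distrib, Finset.sum_sub_distrib]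
    ring
  have key : ∑ j, ∫ ω, (∑ i ∈ s, ξ i ω) j * pderiv j h (Y ω) ∂P -
        σ * ∑ j, ∫ ω, pderiv j (pderiv j h) (Y ω) ∂P =
      σ / 2 * ∑ j, ∑ k, ∫ ω, (∑ i ∈ s, (ξ i ω j * ξ i ω k - C i j k)) *
        pderiv k (pderiv j h) (Y ω) ∂P +
      ∑ i ∈ s, ∫ ω, steinGap h (C i) σ (ξ i ω) (R i ω) ∂P := by
    rw [Finset.sum_congr rfl hgap, Finset.sum_sub_distrib, ← Finset.mul_sum,
      Finset.sum_comm (s := s) (t := Finset.univ),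
      Finset.sum_comm (s := s) (t := Finset.univ)]
    simp_rw [Finset.sum_comm (s := s) (t := Finset.univ), h2, h1]
    simp only [Finset.sum_add_distrib, ← Finset.mul_sum, ite_mul, one_mul, zero_mul,
      Finset.sum_ite_eq, Finset.mem_univ, if_true]
    ring
  rw [key]
  refine (enorm_add_le _ _).trans (add_le_add ?_ ?_)
  · rw [enorm_mul, Real.enorm_of_nonneg (by positivity)]
    gcongr
    refine (enorm_sum_le _ _).trans ?_
    rw [Finset.mul_sum]
    refine Finset.sum_le_sum fun j _ => (enorm_sum_le _ _).trans ?_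
    rw [Finset.mul_sum]
    refine Finset.sum_le_sum fun k _ => (enorm_integral_le_lintegral_enorm _).trans ?_
    calc _ ≤ ∫⁻ ω, supNorm2 h * ‖∑ i ∈ s, (ξ i ω j * ξ i ω k - C i j k)‖ₑ ∂P := by
          refine lintegral_mono fun ω => ?_
          rw [enorm_mul, mul_comm]
          gcongr
          exact enorm_pderiv_le_supNorm2 h k j _
      _ = supNorm2 h * ∫⁻ ω, ‖∑ i ∈ s, (ξ i ω j * ξ i ω k - C i j k)‖ₑ ∂P :=
          lintegral_const_mul' _ _ hh.bdd2.ne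
      _ ≤ _ := by
          gcongr
          exact lintegral_enorm_sum_sub_mean_le s (fun i => hcovint i j k)
            (hind.comp (fun _ x => x j * x k) fun _ => by fun_prop)
  · refine (enorm_sum_le _ _).trans ?_
    rw [← mul_assoc, Finset.mul_sum]
    exact Finset.sum_le_sum fun i hi =>
      enorm_integral_steinGap_indep_le (hξ i) (hξ2 i) (hξ0 i) hh σ (hR i) (hindR i)

end NormalApproximation

/-! ### Interpolation between the sum and the normal law. -/

section Interpolation

variable {d : ℕ} {Ω : Type*} [MeasurableSpace Ω] {P : Measure Ω} [IsProbabilityMeasure P]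

lemma integrable_comp_of_testFunction {h : Vec d → ℝ} (hh : IsTestFunction h) {Y : Ω → Vec d}
    (hY : Measurable Y) (hYi : ∀ j, Integrable (fun ω => Y ω j) P) :
    Integrable (fun ω => h (Y ω)) P := by
  refine (((integrable_finsetSum Finset.univ fun j _ => (hYi j).abs).const_mul
    (supNorm1 h).toReal).add (integrable_const |h 0|)).mono'
    (hh.continuous.measurable.comp hY).aestronglyMeasurable (.of_forall fun ω => ?_)
  have h1 := hh.abs_sub_le (Y ω) 0
  have h2 := abs_sub_abs_le_abs_sub (h (Y ω)) (h 0)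
  simp only [PiLp.zero_apply, sub_zero] at h1
  simp only [Real.norm_eq_abs, Pi.add_apply]
  linarith

/-- The path `φ ↦ E h(sin φ W + cos φ Z)` from the standard normal law to the law of `W`. -/
noncomputable def smartPath (P : Measure Ω) (h : Vec d → ℝ) (W : Ω → Vec d) (φ : ℝ) : ℝ :=
  ∫ p : Ω × Vec d, h (Real.sin φ • W p.1 + Real.cos φ • p.2) ∂(P.prod (stdGaussian (Vec d)))

lemma smartPath_zero (h : Vec d → ℝ) (W : Ω → Vec d) :
    smartPath P h W 0 = ∫ z, h z ∂(stdGaussian (Vec d)) := by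
  simp [smartPath, integral_fun_snd (μ := P)]

lemma smartPath_pi_div_two (h : Vec d → ℝ) (W : Ω → Vec d) :
    smartPath P h W (Real.pi / 2) = ∫ ω, h (W ω) ∂P := by
  simp [smartPath, integral_fun_fst (μ := P) (f := fun ω => h (W ω))]

lemma integrable_coord_stdGaussian (j : Fin d) :
    Integrable (fun z : Vec d => z j) (stdGaussian (Vec d)) := by
  have h : Integrable (fun z : Vec d => z) (stdGaussian (Vec d)) := IsGaussian.integrable_id
  exact (EuclideanSpace.proj j : Vec d →L[ℝ] ℝ).integrable_comp h

lemma hasDerivAt_smartPath {h : Vec d → ℝ} (hh : IsTestFunction h) {W : Ω → Vec d}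
    (hW : Measurable W) (hWi : ∀ j, Integrable (fun ω => W ω j) P) (φ : ℝ) :
    HasDerivAt (smartPath P h W)
      (∫ p : Ω × Vec d, ∑ j, (Real.cos φ * W p.1 j - Real.sin φ * p.2 j) *
        pderiv j h (Real.sin φ • W p.1 + Real.cos φ • p.2) ∂(P.prod (stdGaussian (Vec d)))) φ := by
  have hY : ∀ φ : ℝ, Measurable fun p : Ω × Vec d => Real.sin φ • W p.1 + Real.cos φ • p.2 :=
    fun φ => by fun_prop
  have hWi' : ∀ j, Integrable (fun p : Ω × Vec d => W p.1 j) (P.prod (stdGaussian (Vec d))) :=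
    fun j => (hWi j).comp_fst _
  have hZi' : ∀ j, Integrable (fun p : Ω × Vec d => p.2 j) (P.prod (stdGaussian (Vec d))) :=
    fun j => (integrable_coord_stdGaussian j).comp_snd _
  have hc := hh.continuous_pderiv
  refine (hasDerivAt_integral_of_dominated_loc_of_deriv_le
    (F := fun φ (p : Ω × Vec d) => h (Real.sin φ • W p.1 + Real.cos φ • p.2))
    (F' := fun φ p => ∑ j, (Real.cos φ * W p.1 j - Real.sin φ * p.2 j) *
        pderiv j h (Real.sin φ • W p.1 + Real.cos φ • p.2))
    -- The bound is free of `φ` because `|sin|` and `|cos|` are at most `1`.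
    (bound := fun p => ∑ j, (|W p.1 j| + |p.2 j|) * (supNorm1 h).toReal)
    (s := Set.univ) Filter.univ_mem ?_ ?_ ?_ ?_ ?_ ?_).2
  · exact .of_forall fun φ => (hh.continuous.measurable.comp (hY φ)).aestronglyMeasurable
  · refine integrable_comp_of_testFunction hh (hY φ) fun j => ?_
    simp only [PiLp.add_apply, PiLp.smul_apply, smul_eq_mul]
    exact ((hWi' j).const_mul _).add ((hZi' j).const_mul _)
  · exact Measurable.aestronglyMeasurable (by
      have := fun j => (hc j).measurable.comp (hY φ)
      simp only [Function.comp_def] at this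
      fun_prop)
  · refine .of_forall fun p φ _ => (norm_sum_le _ _).trans (Finset.sum_le_sum fun j _ => ?_)
    rw [norm_mul]
    refine mul_le_mul ?_ (hh.abs_pderiv_le j _) (norm_nonneg _) (by positivity)
    refine (norm_sub_le _ _).trans (add_le_add ?_ ?_)
    · rw [norm_mul]
      exact mul_le_of_le_one_left (norm_nonneg _) (Real.abs_cos_le_one φ)
    · rw [norm_mul]
      exact mul_le_of_le_one_left (norm_nonneg _) (Real.abs_sin_le_one φ)
  · exact integrable_finsetSum _ fun j _ => ((hWi' j).abs.add (hZi' j).abs).mul_const _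
  · refine .of_forall fun p φ _ => ?_
    have h1 : HasDerivAt (fun φ : ℝ => Real.sin φ • W p.1 + Real.cos φ • p.2)
        (Real.cos φ • W p.1 + (-Real.sin φ) • p.2) φ :=
      ((Real.hasDerivAt_sin φ).smul_const _).add ((Real.hasDerivAt_cos φ).smul_const _)
    refine ((hh.diff1 _).hasFDerivAt.comp_hasDerivAt φ h1).congr_deriv ?_
    rw [fderiv_apply_eq_sum_pderiv]
    refine Finset.sum_congr rfl fun j _ => ?_
    simp
    left; ring

/-- Integrating by parts in the normal variable turns `p.2 j * ∂_j h` into `c ∂_j ∂_j h`, so the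
factor `c` comes out of both terms. -/
lemma deriv_smartPath_eq {h : Vec d → ℝ} (hh : IsTestFunction h) {W : Ω → Vec d}
    (hW : Measurable W) (hWi : ∀ j, Integrable (fun ω => W ω j) P) (σ c : ℝ) :
    ∫ p : Ω × Vec d, ∑ j, (c * W p.1 j - σ * p.2 j) *
        pderiv j h (σ • W p.1 + c • p.2) ∂(P.prod (stdGaussian (Vec d))) =
      c * ∫ z, (∑ j, ∫ ω, W ω j * pderiv j h (σ • W ω + c • z) ∂P -
        σ * ∑ j, ∫ ω, pderiv j (pderiv j h) (σ • W ω + c • z) ∂P) ∂(stdGaussian (Vec d)) := by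
  set γ := stdGaussian (Vec d)
  have hY : Measurable fun p : Ω × Vec d => σ • W p.1 + c • p.2 := by fun_prop
  have i1 : ∀ j, Integrable (fun p : Ω × Vec d => W p.1 j * pderiv j h (σ • W p.1 + c • p.2))
      (P.prod γ) := fun j => ((hWi j).comp_fst _).mul_bdd
    ((hh.continuous_pderiv j).measurable.comp hY).aestronglyMeasurable
    (.of_forall fun _ => hh.abs_pderiv_le j _)
  have i2 : ∀ j, Integrable (fun p : Ω × Vec d => p.2 j * pderiv j h (σ • W p.1 + c • p.2))
      (P.prod γ) := fun j => ((integrable_coord_stdGaussian j).comp_snd _).mul_bdd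
    ((hh.continuous_pderiv j).measurable.comp hY).aestronglyMeasurable
    (.of_forall fun _ => hh.abs_pderiv_le j _)
  have i3 : ∀ j, Integrable (fun p : Ω × Vec d => pderiv j (pderiv j h) (σ • W p.1 + c • p.2))
      (P.prod γ) := fun j => .of_bound
    ((hh.continuous_pderiv2 j j).measurable.comp hY).aestronglyMeasurable _
    (.of_forall fun _ => hh.abs_pderiv2_le j j _)
  have e : ∀ p : Ω × Vec d, ∑ j, (c * W p.1 j - σ * p.2 j) * pderiv j h (σ • W p.1 + c • p.2) =
      ∑ j, (c * (W p.1 j * pderiv j h (σ • W p.1 + c • p.2)) -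
        σ * (p.2 j * pderiv j h (σ • W p.1 + c • p.2))) := fun p =>
    Finset.sum_congr rfl fun j _ => by ring
  have e2 : ∀ j, ∫ p : Ω × Vec d, p.2 j * pderiv j h (σ • W p.1 + c • p.2) ∂(P.prod γ) =
      c * ∫ p : Ω × Vec d, pderiv j (pderiv j h) (σ • W p.1 + c • p.2) ∂(P.prod γ) := by
    intro j
    rw [integral_prod _ (i2 j), integral_prod _ (i3 j), ← integral_const_mul]
    exact integral_congr_ae (.of_forall fun ω => integral_coord_mul_affine_stdGaussian j
      (hh.diff2 j) (hh.abs_pderiv_le j) (hh.abs_pderiv2_le j j) (hh.continuous_pderiv2 j j)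
      (σ • W ω) c)
  have i4 : ∀ j, Integrable (fun p : Ω × Vec d => c * (W p.1 j * pderiv j h (σ • W p.1 + c • p.2)) -
      σ * (p.2 j * pderiv j h (σ • W p.1 + c • p.2))) (P.prod γ) := fun j =>
    ((i1 j).const_mul c).sub ((i2 j).const_mul σ)
  simp_rw [e]
  rw [integral_finsetSum _ fun j _ => i4 j,
    integral_sub (integrable_finsetSum _ fun j _ => (i1 j).integral_prod_right)
      ((integrable_finsetSum _ fun j _ => (i3 j).integral_prod_right).const_mul σ),
    integral_const_mul, integral_finsetSum _ fun j _ => (i1 j).integral_prod_right,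
    integral_finsetSum _ fun j _ => (i3 j).integral_prod_right,
    mul_sub, Finset.mul_sum, Finset.mul_sum, Finset.mul_sum, ← Finset.sum_sub_distrib]
  refine Finset.sum_congr rfl fun j _ => ?_
  rw [integral_sub ((i1 j).const_mul c) ((i2 j).const_mul σ), integral_const_mul,
    integral_const_mul, e2, integral_prod_symm _ (i1 j), integral_prod_symm _ (i3 j)]
  ring

variable {ι : Type*} {s : Finset ι} {ξ : ι → Ω → Vec d}

/-- Multivariate normal approximation of a sum of independent centred random vectors, for three
times differentiable test functions. -/
theorem enorm_integral_sum_sub_stdGaussian_le (hξ : ∀ i, Measurable (ξ i)) (hind : iIndepFun ξ P)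
    (hξ2 : ∀ i j, MemLp (fun ω => ξ i ω j) 2 P) (hξ0 : ∀ i j, ∫ ω, ξ i ω j ∂P = 0)
    (hcov : ∀ j k, ∑ i ∈ s, ∫ ω, ξ i ω j * ξ i ω k ∂P = if j = k then 1 else 0)
    {h : Vec d → ℝ} (hh : IsTestFunction h) :
    ‖∫ ω, h (∑ i ∈ s, ξ i ω) ∂P - ∫ z, h z ∂(stdGaussian (Vec d))‖ₑ ≤
      4⁻¹ * (supNorm2 h *
        ∑ j, ∑ k, esqrt (∑ i ∈ s, evariance (fun ω => ξ i ω j * ξ i ω k) P)) +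
      12⁻¹ * (supNorm3 h *
        ∑ i ∈ s, ∫⁻ p : Ω × Ω, (∑ m, ‖ξ i p.2 m - ξ i p.1 m‖ₑ) ^ 3 ∂(P.prod P)) := by
  set a := supNorm2 h * ∑ j, ∑ k, esqrt (∑ i ∈ s, evariance (fun ω => ξ i ω j * ξ i ω k) P) with ha
  set b := supNorm3 h *
    ∑ i ∈ s, ∫⁻ p : Ω × Ω, (∑ m, ‖ξ i p.2 m - ξ i p.1 m‖ₑ) ^ 3 ∂(P.prod P) with hb
  -- Infinite error terms are trivial; afterwards the differential inequality can be stated with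
  -- real numbers.
  by_cases ha' : a = ∞
  · simp [ha', ENNReal.mul_top]
  by_cases hb' : b = ∞
  · simp [hb', ENNReal.mul_top]
  set W : Ω → Vec d := fun ω => ∑ i ∈ s, ξ i ω with hWdef
  have hW : Measurable W := by fun_prop
  have hWi : ∀ j, Integrable (fun ω => W ω j) P := by
    intro j
    have := integrable_finsetSum s fun i _ => integrable_coord (hξ2 i) j
    simpa [hWdef] using this
  set F' : ℝ → ℝ := fun φ => ∫ p : Ω × Vec d, ∑ j, (Real.cos φ * W p.1 j - Real.sin φ * p.2 j) *
        pderiv j h (Real.sin φ • W p.1 + Real.cos φ • p.2) ∂(P.prod (stdGaussian (Vec d))) with hF'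
  have hF := fun φ => hasDerivAt_smartPath (P := P) hh hW hWi φ
  have hbound : ∀ φ ∈ Set.Ico 0 (Real.pi / 2), ‖F' φ‖ ≤
      Real.cos φ * (Real.sin φ / 2 * a.toReal + Real.sin φ ^ 2 / 4 * b.toReal) := by
    intro φ hφ
    have hsin : 0 ≤ Real.sin φ := Real.sin_nonneg_of_nonneg_of_le_pi hφ.1 (by
      have := hφ.2; have := Real.pi_pos; linarith)
    have hcos : 0 ≤ Real.cos φ := Real.cos_nonneg_of_mem_Icc ⟨by
      have := hφ.1; have := Real.pi_pos; linarith, hφ.2.le⟩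
    rw [hF']
    simp only []
    rw [deriv_smartPath_eq hh hW hWi, norm_mul, Real.norm_of_nonneg hcos]
    refine mul_le_mul_of_nonneg_left ?_ hcos
    have hrhs : 0 ≤ Real.sin φ / 2 * a.toReal + Real.sin φ ^ 2 / 4 * b.toReal := by positivity
    rw [Real.norm_eq_abs, ← ENNReal.ofReal_le_ofReal_iff hrhs, ← Real.enorm_eq_ofReal_abs,
      ENNReal.ofReal_add (by positivity) (by positivity), ENNReal.ofReal_mul (by positivity),
      ENNReal.ofReal_mul (by positivity), ENNReal.ofReal_toReal ha', ENNReal.ofReal_toReal hb']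
    refine (enorm_integral_le_lintegral_enorm _).trans ?_
    refine (lintegral_mono fun z => enorm_gradient_gap_le hξ hind hξ2 hξ0 hcov hh hsin
      (Real.cos φ • z)).trans ?_
    simp [ha, hb]
  -- The comparison function is the antiderivative of `cos φ (sin φ / 2 a + sin² φ / 4 b)`; at `π/2`
  -- it equals `a/4 + b/12`.
  have hpath := image_norm_le_of_norm_deriv_right_le_deriv_boundary (a := 0) (b := Real.pi / 2)
    (f := fun φ => smartPath P h W φ - smartPath P h W 0) (f' := F')
    (B := fun φ => Real.sin φ ^ 2 / 4 * a.toReal + Real.sin φ ^ 3 / 12 * b.toReal)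
    (B' := fun φ => Real.cos φ * (Real.sin φ / 2 * a.toReal + Real.sin φ ^ 2 / 4 * b.toReal))
    (fun φ _ => ((hF φ).sub_const _).continuousAt.continuousWithinAt)
    (fun φ _ => ((hF φ).sub_const _).hasDerivWithinAt) (by simp)
    (fun φ => by
      have := ((((Real.hasDerivAt_sin φ).fun_pow 2).div_const 4).mul_const a.toReal).fun_add
        ((((Real.hasDerivAt_sin φ).fun_pow 3).div_const 12).mul_const b.toReal)
      refine this.congr_deriv ?_
      simp
      ring)
    hbound (Set.right_mem_Icc.2 (by positivity))
  simp only [smartPath_zero, smartPath_pi_div_two, Real.sin_pi_div_two] at hpath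
  rw [Real.enorm_eq_ofReal_abs]
  refine (ENNReal.ofReal_le_ofReal hpath).trans_eq ?_
  rw [ENNReal.ofReal_add (by positivity) (by positivity), ENNReal.ofReal_mul (by positivity),
    ENNReal.ofReal_mul (by positivity), ENNReal.ofReal_toReal ha', ENNReal.ofReal_toReal hb']
  congr 2 <;> simp [ENNReal.ofReal_inv_of_pos]

end Interpolation

/-! ### Derivatives of the log-likelihood and expansion of the likelihood equation. -/

section LikelihoodCalculus

variable {t d : ℕ}

/-- Needed because `logLik` is known to be a sum of log-densities only on `Θ`, where the densities
are positive; agreement on an open set suffices for derivatives. -/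
lemma pderiv_congr {g g' : Vec d → ℝ} {U : Set (Vec d)} (hU : IsOpen U)
    (hgg : ∀ y ∈ U, g y = g' y) (k : Fin d) {x : Vec d} (hx : x ∈ U) :
    pderiv k g x = pderiv k g' x := by
  have : g =ᶠ[𝓝 x] g' := Filter.eventually_of_mem (hU.mem_nhds hx) hgg
  rw [pderiv, pderiv, this.fderiv_eq]

lemma differentiableAt_congr {g g' : Vec d → ℝ} {U : Set (Vec d)} (hU : IsOpen U)
    (hgg : ∀ y ∈ U, g y = g' y) {x : Vec d} (hx : x ∈ U) (hg' : DifferentiableAt ℝ g' x) :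
    DifferentiableAt ℝ g x :=
  hg'.congr_of_eventuallyEq (Filter.eventually_of_mem (hU.mem_nhds hx) hgg)

lemma pderiv_sum {ι : Type*} (s : Finset ι) {g : ι → Vec d → ℝ} {x : Vec d}
    (hg : ∀ i ∈ s, DifferentiableAt ℝ (g i) x) (k : Fin d) :
    pderiv k (fun y => ∑ i ∈ s, g i y) x = ∑ i ∈ s, pderiv k (g i) x := by
  simp [pderiv, fderiv_fun_sum hg]

/-- Third-order mixed partial derivatives may be reversed. -/
lemma pderiv_pderiv_pderiv_rev {l : Vec d → ℝ} {U : Set (Vec d)} (hU : IsOpen U)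
    (h1 : ∀ θ ∈ U, DifferentiableAt ℝ l θ) (h2 : ∀ θ ∈ U, ∀ b, DifferentiableAt ℝ (pderiv b l) θ)
    (h3 : ∀ θ ∈ U, ∀ a b, DifferentiableAt ℝ (pderiv a (pderiv b l)) θ) {θ : Vec d} (hθ : θ ∈ U)
    (i j k : Fin d) :
    pderiv i (pderiv j (pderiv k l)) θ = pderiv k (pderiv j (pderiv i l)) θ := by
  rw [pderiv_congr hU (fun y hy => pderiv_comm hU hy h1 (h2 y hy) j k) i hθ,
    pderiv_comm hU hθ (fun y hy => h2 y hy j) (fun a => h3 θ hθ a j) i k,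
    pderiv_congr hU (fun y hy => pderiv_comm hU hy h1 (h2 y hy) i j) k hθ]

lemma isOpen_near {Θ : Set (Vec d)} (hΘ : IsOpen Θ) (θ₀ : Vec d) (ε : ℝ) :
    IsOpen {θ | θ ∈ Θ ∧ ∀ j, |θ j - θ₀ j| < ε} := by
  have : {θ : Vec d | θ ∈ Θ ∧ ∀ j, |θ j - θ₀ j| < ε} = Θ ∩ ⋂ j, {θ : Vec d | |θ j - θ₀ j| < ε} := by
    ext; simp
  rw [this]
  exact hΘ.inter (isOpen_iInter_of_finite fun j => isOpen_lt (by fun_prop) continuous_const)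

/-- Expansion of the gradient at a reference point near a critical point. -/
lemma abs_gradient_expansion_le {Θ : Set (Vec d)} (hΘ : IsOpen Θ) {l : Vec d → ℝ}
    {θ₀ θ' : Vec d} {ε : ℝ} (hstar : StarConvex ℝ θ₀ {θ | θ ∈ Θ ∧ ∀ j, |θ j - θ₀ j| < ε})
    (h1 : ∀ θ ∈ Θ, DifferentiableAt ℝ l θ) (h2 : ∀ θ ∈ Θ, ∀ b, DifferentiableAt ℝ (pderiv b l) θ)
    {m : Fin d → Fin d → Fin d → ℝ}
    (h3 : ∀ θ ∈ Θ, (∀ j, |θ j - θ₀ j| < ε) → ∀ k j v,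
      DifferentiableAt ℝ (pderiv j (pderiv v l)) θ ∧ |pderiv k (pderiv j (pderiv v l)) θ| ≤ m k j v)
    (hθ' : θ' ∈ Θ) (hnear : ∀ j, |θ' j - θ₀ j| < ε) (hcrit : ∀ k, pderiv k l θ' = 0) (k : Fin d) :
    |pderiv k l θ₀ + ∑ j, (θ' j - θ₀ j) * pderiv j (pderiv k l) θ₀| ≤
      (∑ j, ∑ v, |θ' j - θ₀ j| * |θ' v - θ₀ v| * m k j v) / 2 := by
  set U : Set (Vec d) := {θ | θ ∈ Θ ∧ ∀ j, |θ j - θ₀ j| < ε}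
  have hU : IsOpen U := isOpen_near hΘ θ₀ ε
  have hseg : ∀ τ ∈ Set.Icc (0 : ℝ) 1, θ₀ + τ • (θ' - θ₀) ∈ U := fun τ hτ =>
    hstar.add_smul_sub_mem (show θ' ∈ U from ⟨hθ', hnear⟩) hτ.1 hτ.2
  have := abs_taylor_segment_le (g := pderiv k l) (u := θ₀) (v := θ' - θ₀)
    (fun τ hτ => h2 _ (hseg τ hτ).1 k)
    (fun τ hτ j => (h3 _ (hseg τ hτ).1 (hseg τ hτ).2 k j k).1)
    (C := ∑ j, ∑ v, |θ' j - θ₀ j| * |θ' v - θ₀ v| * m k j v)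
    (fun τ hτ => Finset.sum_le_sum fun j _ => Finset.sum_le_sum fun v _ => by
      -- The bounds `m` need not be symmetric in their indices, so the derivatives are reversed to
      -- match the order in which `h3` bounds them.
      rw [pderiv_pderiv_pderiv_rev hU (fun θ hθ => h1 θ hθ.1) (fun θ hθ => h2 θ hθ.1)
        (fun θ hθ a b => (h3 θ hθ.1 hθ.2 a a b).1) (hseg τ hτ)]
      exact mul_le_mul_of_nonneg_left (h3 _ (hseg τ hτ).1 (hseg τ hτ).2 k j v).2 (by positivity))
  rw [add_sub_cancel, hcrit, zero_sub, ← neg_add', abs_neg] at this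
  exact this

variable {f : ℕ → Vec t → Vec d → ℝ} {Θ : Set (Vec d)} {n : ℕ} {x : Fin n → Vec t}

lemma likelihood_pos (hpos : ∀ i : Fin n, ∀ θ ∈ Θ, 0 < f i (x i) θ) {θ : Vec d} (hθ : θ ∈ Θ) :
    0 < likelihood f n x θ := Finset.prod_pos fun i _ => hpos i θ hθ

lemma logLik_eq_sum (hpos : ∀ i : Fin n, ∀ θ ∈ Θ, 0 < f i (x i) θ) {θ : Vec d} (hθ : θ ∈ Θ) :
    logLik f n x θ = ∑ i : Fin n, logDens f i (x i) θ :=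
  Real.log_prod fun i _ => (hpos i θ hθ).ne'

section

variable (hΘ : IsOpen Θ) (hpos : ∀ i : Fin n, ∀ θ ∈ Θ, 0 < f i (x i) θ)
  (hgrad : ∀ i : Fin n, ∀ θ ∈ Θ, DifferentiableAt ℝ (logDens f i (x i)) θ)
  (hhess : ∀ i : Fin n, ∀ θ ∈ Θ, ∀ b, DifferentiableAt ℝ (pderiv b (logDens f i (x i))) θ)
include hΘ hpos hgrad

lemma differentiableAt_logLik {θ : Vec d} (hθ : θ ∈ Θ) : DifferentiableAt ℝ (logLik f n x) θ :=
  differentiableAt_congr hΘ (fun _ hy => logLik_eq_sum hpos hy) hθ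
    (DifferentiableAt.fun_sum fun i _ => hgrad i θ hθ)

lemma pderiv_logLik (k : Fin d) {θ : Vec d} (hθ : θ ∈ Θ) :
    pderiv k (logLik f n x) θ = ∑ i : Fin n, score f i k (x i) θ := by
  rw [pderiv_congr hΘ (fun _ hy => logLik_eq_sum hpos hy) k hθ,
    pderiv_sum _ fun i _ => hgrad i θ hθ]
  rfl

omit hgrad in
-- The maximiser lies in the open set `Θ`, hence is an interior maximum, and the logarithm is
-- monotone on positive likelihoods.
lemma pderiv_logLik_eq_zero {θ' : Vec d} (hMLE : IsUniqueMLE f Θ n x θ') (k : Fin d) :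
    pderiv k (logLik f n x) θ' = 0 := by
  have hmax : IsLocalMax (logLik f n x) θ' := by
    refine Filter.eventually_of_mem (hΘ.mem_nhds hMLE.1) fun θ hθ => ?_
    refine Real.log_le_log (likelihood_pos hpos hθ) ?_
    by_cases h : θ = θ'
    · rw [h]
    · exact (hMLE.2 θ hθ h).le
  simp [pderiv, hmax.fderiv_eq_zero]

include hhess

lemma differentiableAt_pderiv_logLik (k : Fin d) {θ : Vec d} (hθ : θ ∈ Θ) :
    DifferentiableAt ℝ (pderiv k (logLik f n x)) θ :=
  differentiableAt_congr hΘ (fun _ hy => pderiv_logLik hΘ hpos hgrad k hy) hθ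
    (DifferentiableAt.fun_sum fun i _ => hhess i θ hθ k)

lemma pderiv_pderiv_logLik (j k : Fin d) {θ : Vec d} (hθ : θ ∈ Θ) :
    pderiv j (pderiv k (logLik f n x)) θ = ∑ i : Fin n, hess f i j k (x i) θ := by
  rw [pderiv_congr hΘ (fun _ hy => pderiv_logLik hΘ hpos hgrad k hy) j hθ]
  exact pderiv_sum _ (fun i _ => hhess i θ hθ k) j

end

end LikelihoodCalculus

/-! ### A measurable version of the score. -/

section ScoreMeasurability

variable {Ω : Type*} [MeasurableSpace Ω] {t d : ℕ}

/-- The score at `θ₀`, as a function of an observation at which the density is differentiable,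
is a limit of measurable difference quotients. -/
lemma exists_measurable_score {P : Measure Ω} {Θ : Set (Vec d)} {θ₀ : Vec d}
    (hθ₀ : θ₀ ∈ Θ) {f : ℕ → Vec t → Vec d → ℝ} {i : ℕ} (hΘ : IsOpen Θ)
    (hf : ∀ θ ∈ Θ, Measurable fun x => f i x θ) {X : Ω → Vec t}
    (hgrad : ∀ᵐ ω ∂P, ∀ θ ∈ Θ, DifferentiableAt ℝ (logDens f i (X ω)) θ) (a : Fin d) :
    ∃ g : Vec t → ℝ, Measurable g ∧ ∀ᵐ ω ∂P, score f i a (X ω) θ₀ = g (X ω) := by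
  classical
  set e : Vec d := EuclideanSpace.single a 1
  set τ : ℕ → ℝ := fun m => 1 / ((m : ℝ) + 1)
  have hτ : Tendsto τ atTop (𝓝 0) := tendsto_one_div_add_atTop_nhds_zero_nat
  -- Densities are known to be measurable only for parameters in `Θ`, hence the value `0` outside;
  -- openness of `Θ` makes this irrelevant in the limit.
  set u : ℕ → Vec t → ℝ := fun m x =>
    if θ₀ + τ m • e ∈ Θ then (τ m)⁻¹ * (logDens f i x (θ₀ + τ m • e) - logDens f i x θ₀) else 0
  have hu : ∀ m, Measurable (u m) := by
    intro m
    by_cases hm : θ₀ + τ m • e ∈ Θ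
    · simp only [u, hm, if_true, logDens]
      exact (((hf _ hm).log).sub ((hf _ hθ₀).log)).const_mul _
    · simp only [u, hm, if_false]
      exact measurable_const
  refine ⟨fun x => limsup (fun m => u m x) atTop, Measurable.limsup hu, ?_⟩
  filter_upwards [hgrad] with ω hω
  refine (Tendsto.limsup_eq ?_).symm
  have hd := (hω θ₀ hθ₀).hasFDerivAt.hasLineDerivAt e
  have hd' := hd.tendsto_slope_zero.comp (g := fun t => t⁻¹ • (logDens f i (X ω) (θ₀ + t • e) -
    logDens f i (X ω) θ₀)) (f := τ) (x := atTop) (tendsto_nhdsWithin_iff.2 ⟨hτ, .of_forall fun m => by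
      simp only [τ, Set.mem_compl_iff, Set.mem_singleton_iff]; positivity⟩)
  refine hd'.congr' ?_
  have hin : ∀ᶠ m in atTop, θ₀ + τ m • e ∈ Θ := by
    have : Tendsto (fun m => θ₀ + τ m • e) atTop (𝓝 θ₀) := by
      simpa using (hτ.smul_const e).const_add θ₀
    exact this (hΘ.mem_nhds hθ₀)
  filter_upwards [hin] with m hm
  simp [u, hm]

end ScoreMeasurability

/-! ### The matrix root of the average information and its inverse. -/

section Root

variable {Ω : Type*} [MeasurableSpace Ω] {t d : ℕ} {P : Measure Ω} {X : ℕ → Ω → Vec t}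
  {f : ℕ → Vec t → Vec d → ℝ} {n : ℕ} {θ₀ : Vec d}

lemma rootFisher_mul_self (hpos : (avgFisher P X f n θ₀).PosDef) :
    rootFisher P X f n θ₀ * rootFisher P X f n θ₀ = avgFisher P X f n θ₀ :=
  CFC.sqrt_mul_sqrt_self _ hpos.posSemidef.nonneg

lemma rootFisher_transpose : (rootFisher P X f n θ₀).transpose = rootFisher P X f n θ₀ := by
  have h : (rootFisher P X f n θ₀).PosSemidef :=
    Matrix.nonneg_iff_posSemidef.1 (CFC.sqrt_nonneg (avgFisher P X f n θ₀))
  simpa [Matrix.conjTranspose_eq_transpose_of_trivial] using h.isHermitian.eq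

lemma isUnit_det_rootFisher (hpos : (avgFisher P X f n θ₀).PosDef) :
    IsUnit (rootFisher P X f n θ₀).det := by
  have h1 := hpos.det_pos
  rw [← rootFisher_mul_self hpos, Matrix.det_mul] at h1
  exact isUnit_iff_ne_zero.2 fun h => by simp [h] at h1

lemma invRootFisher_mul_avgFisher (hpos : (avgFisher P X f n θ₀).PosDef) :
    invRootFisher P X f n θ₀ * avgFisher P X f n θ₀ = rootFisher P X f n θ₀ := by
  rw [← rootFisher_mul_self hpos, invRootFisher, ← Matrix.mul_assoc,
    Matrix.nonsing_inv_mul _ (isUnit_det_rootFisher hpos), Matrix.one_mul]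

lemma invRootFisher_mul_avgFisher_mul_transpose (hpos : (avgFisher P X f n θ₀).PosDef) :
    invRootFisher P X f n θ₀ * avgFisher P X f n θ₀ * (invRootFisher P X f n θ₀).transpose = 1 := by
  rw [invRootFisher_mul_avgFisher hpos, invRootFisher, Matrix.transpose_nonsing_inv,
    rootFisher_transpose, Matrix.mul_nonsing_inv _ (isUnit_det_rootFisher hpos)]

end Root

/-! ### The standardised score as a sum of centred independent vectors. -/

section ScoreApproximation

variable {Ω : Type*} [MeasurableSpace Ω] {t d : ℕ}

/-- The standardised score `n^{-1/2} [Ī_n(θ₀)]^{-1/2} ∇l_n(θ₀)`. -/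
noncomputable def normScore (P : Measure Ω) (X : ℕ → Ω → Vec t) (f : ℕ → Vec t → Vec d → ℝ) (n : ℕ)
    (θ₀ : Vec d) (ω : Ω) : Vec d :=
  WithLp.toLp 2 fun a => (√(n : ℝ))⁻¹ * ∑ b, invRootFisher P X f n θ₀ a b *
    ∑ i ∈ Finset.range n, score f i b (X i ω) θ₀

/-- The summands of the standardised score. -/
noncomputable def normScoreSummand (P : Measure Ω) (X : ℕ → Ω → Vec t) (f : ℕ → Vec t → Vec d → ℝ)
    (n : ℕ) (θ₀ : Vec d) (i : ℕ) (ω : Ω) (a : Fin d) : ℝ :=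
  (√(n : ℝ))⁻¹ * ∑ b, invRootFisher P X f n θ₀ a b * score f i b (X i ω) θ₀

variable {P : Measure Ω} {Θ : Set (Vec d)} {ν : ℕ → Measure (Vec t)}
  {f : ℕ → Vec t → Vec d → ℝ} {θ₀ : Vec d} {X : ℕ → Ω → Vec t}
  {θhat : (n : ℕ) → (Fin n → Vec t) → Vec d} {n : ℕ}

lemma normScore_apply (ω : Ω) (a : Fin d) :
    normScore P X f n θ₀ ω a = ∑ i ∈ Finset.range n, normScoreSummand P X f n θ₀ i ω a := by
  simp only [normScore, normScoreSummand, Finset.mul_sum]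
  rw [Finset.sum_comm]

section

variable (hreg : Regularity P X f Θ θ₀ θhat)
include hreg

lemma memLp_score (i : ℕ) (b : Fin d) : MemLp (fun ω => score f i b (X i ω) θ₀) 2 P :=
  (memLp_two_iff_integrable_sq (hreg.score_integrable i b).aestronglyMeasurable).2 (by
    simpa [sq] using hreg.prod_integrable i b b)

lemma memLp_normScoreSummand (i : ℕ) (a : Fin d) :
    MemLp (fun ω => normScoreSummand P X f n θ₀ i ω a) 2 P :=
  (memLp_finsetSum _ fun b _ => (memLp_score hreg i b).const_mul _).const_mul _

lemma integral_normScoreSummand (i : ℕ) (a : Fin d) :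
    ∫ ω, normScoreSummand P X f n θ₀ i ω a ∂P = 0 := by
  unfold normScoreSummand
  rw [integral_const_mul, integral_finsetSum _ fun b _ => (hreg.score_integrable i b).const_mul _]
  simp [integral_const_mul, hreg.score_mean]

/-- The information equality makes the summed covariance `A B Aᵀ`, where `A` is the inverse root of
`B = avgFisher`; this product is the identity. -/
lemma sum_integral_normScoreSummand_mul (hn : 1 ≤ n) (hpos : (avgFisher P X f n θ₀).PosDef)
    (j k : Fin d) :
    ∑ i ∈ Finset.range n, ∫ ω, normScoreSummand P X f n θ₀ i ω j *
      normScoreSummand P X f n θ₀ i ω k ∂P = if j = k then 1 else 0 := by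
  set A := invRootFisher P X f n θ₀ with hA
  have hsq : (√(n : ℝ))⁻¹ * (√(n : ℝ))⁻¹ = (n : ℝ)⁻¹ := by
    rw [← mul_inv, Real.mul_self_sqrt (by positivity)]
  have h1 : ∀ i, ∫ ω, normScoreSummand P X f n θ₀ i ω j *
      normScoreSummand P X f n θ₀ i ω k ∂P =
        ∑ b, ∑ c, A j b * A k c * ((n : ℝ)⁻¹ * fisher P X f i θ₀ b c) := by
    intro i
    have e : ∀ ω, normScoreSummand P X f n θ₀ i ω j * normScoreSummand P X f n θ₀ i ω k =
        ∑ b, ∑ c, A j b * A k c * ((n : ℝ)⁻¹ *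
          (score f i b (X i ω) θ₀ * score f i c (X i ω) θ₀)) := by
      intro ω
      rw [normScoreSummand, normScoreSummand, mul_mul_mul_comm, hsq, Finset.sum_mul_sum,
        Finset.mul_sum]
      refine Finset.sum_congr rfl fun b _ => ?_
      rw [Finset.mul_sum]
      exact Finset.sum_congr rfl fun c _ => by ring
    have hi := fun b c => ((hreg.prod_integrable i b c).const_mul ((n : ℝ)⁻¹)).const_mul
      (A j b * A k c)
    simp_rw [e]
    rw [integral_finsetSum _ fun b _ => integrable_finsetSum _ fun c _ => hi b c]
    refine Finset.sum_congr rfl fun b _ => ?_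
    rw [integral_finsetSum _ fun c _ => hi b c]
    refine Finset.sum_congr rfl fun c _ => ?_
    rw [integral_const_mul, integral_const_mul, hreg.info_eq]
    rfl
  simp_rw [h1]
  have h2 := congrFun (congrFun (invRootFisher_mul_avgFisher_mul_transpose hpos) j) k
  rw [Matrix.one_apply] at h2
  rw [← h2, ← hA, Finset.sum_comm, Matrix.mul_apply]
  simp_rw [Matrix.mul_apply, Finset.sum_mul]
  rw [Finset.sum_comm (s := Finset.univ) (t := Finset.univ)]
  refine Finset.sum_congr rfl fun b _ => ?_
  rw [Finset.sum_comm]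
  refine Finset.sum_congr rfl fun c _ => ?_
  simp only [avgFisher, Matrix.smul_apply, Matrix.sum_apply, smul_eq_mul, Finset.mul_sum,
    Finset.sum_mul, Matrix.transpose_apply]
  exact Finset.sum_congr rfl fun i _ => by ring

/-- The summands are replaced by Borel functions of the single observations, which inherit
independence and agree with them almost surely. -/
lemma exists_measurable_normScoreSummand (hΘ : IsOpen Θ) (hf : IsModel ν f Θ) (hθ₀ : θ₀ ∈ Θ)
    (hX : IsObservation P X ν f θ₀) (n : ℕ) :
    ∃ ξ : ℕ → Ω → Vec d, (∀ i, Measurable (ξ i)) ∧ iIndepFun ξ P ∧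
      ∀ i, ∀ᵐ ω ∂P, ∀ a, ξ i ω a = normScoreSummand P X f n θ₀ i ω a := by
  choose g hg hgs using fun i a => exists_measurable_score hθ₀ hΘ (fun θ hθ => hf.measurable i θ hθ)
    (hreg.grad_exists i) a
  set G : ℕ → Vec t → Vec d := fun i x => WithLp.toLp 2 fun a =>
    (√(n : ℝ))⁻¹ * ∑ b, invRootFisher P X f n θ₀ a b * g i b x
  have hG : ∀ i, Measurable (G i) := by
    intro i
    refine (WithLp.measurable_toLp 2 _).comp (measurable_pi_lambda _ fun a => ?_)
    exact (Finset.measurable_sum _ fun b _ => (hg i b).const_mul _).const_mul _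
  refine ⟨fun i ω => G i (X i ω), fun i => (hG i).comp (hX.measurable i), hX.indep.comp G hG,
    fun i => ?_⟩
  filter_upwards [ae_all_iff.2 fun a => hgs i a] with ω hω a
  simp only [G, normScoreSummand, hω]

end

end ScoreApproximation

lemma enorm_inv_sqrt_natCast (n : ℕ) (hn : 1 ≤ n) : ‖(√(n : ℝ))⁻¹‖ₑ = (esqrt n)⁻¹ := by
  have h0 : √(n : ℝ) ≠ 0 := by positivity
  rw [enorm_inv h0, Real.enorm_of_nonneg (by positivity), Real.sqrt_eq_rpow, esqrt,
    ← ENNReal.ofReal_rpow_of_nonneg (by positivity) (by norm_num), ENNReal.ofReal_natCast]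

lemma sum_sum_eq_sum_diag_add_two_mul {d : ℕ} {V : Fin d → Fin d → ℝ≥0∞}
    (hV : ∀ j k, V j k = V k j) :
    ∑ j, ∑ k, V j k = ∑ j, V j j + 2 * ∑ k, ∑ j ∈ Finset.Ioi k, V j k := by
  have h1 : ∀ j, ∑ k, V j k = V j j + ∑ k ∈ {j}ᶜ, V k j := by
    intro j
    rw [Fintype.sum_eq_add_sum_compl j]
    exact congrArg _ (Finset.sum_congr rfl fun k _ => hV j k)
  simp_rw [h1]
  rw [Finset.sum_add_distrib, ← Finset.sum_sum_Ioi_add_eq_sum_sum_off_diag, Finset.mul_sum]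
  congr 1
  refine Finset.sum_congr rfl fun k _ => ?_
  rw [Finset.mul_sum]
  exact Finset.sum_congr rfl fun j _ => by rw [hV k j, two_mul]

/-! ### Normal approximation of the standardised score, with constants `K2` and `K3`. -/

section ScoreApproximation

variable {Ω : Type*} [MeasurableSpace Ω] {t d : ℕ}
  {P : Measure Ω} [IsProbabilityMeasure P] {Θ : Set (Vec d)} {ν : ℕ → Measure (Vec t)}
  {f : ℕ → Vec t → Vec d → ℝ} {θ₀ : Vec d} {X : ℕ → Ω → Vec t}
  {θhat : (n : ℕ) → (Fin n → Vec t) → Vec d} {n : ℕ}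

omit [IsProbabilityMeasure P] in
-- The products of summands carry a factor `1/n`, shared equally between `K2` and the prefactor.
-- Symmetry in `j, k` counts each off-diagonal pair twice, which turns `1/4` into `1/2`.
lemma sum_esqrt_evariance_eq (hn : 1 ≤ n) :
    4⁻¹ * ∑ j, ∑ k, esqrt (∑ i ∈ Finset.range n, evariance (fun ω =>
      normScoreSummand P X f n θ₀ i ω j * normScoreSummand P X f n θ₀ i ω k) P) =
    (esqrt n)⁻¹ * K2 P X f n θ₀ := by
  set A := invRootFisher P X f n θ₀ with hA
  set T : Fin d → Fin d → ℕ → Ω → ℝ := fun j k i ω => ∑ q, ∑ v, A j q * A k v *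
    score f i q (X i ω) θ₀ * score f i v (X i ω) θ₀ with hT
  have hTeq : ∀ j k i ω, T j k i ω = (∑ q, A j q * score f i q (X i ω) θ₀) *
      ∑ v, A k v * score f i v (X i ω) θ₀ := by
    intro j k i ω
    rw [Finset.sum_mul_sum]
    exact Finset.sum_congr rfl fun q _ => Finset.sum_congr rfl fun v _ => by ring
  set V : Fin d → Fin d → ℝ≥0∞ := fun j k =>
    esqrt (∑ i ∈ Finset.range n, evariance (T j k i) P) with hV
  have hVsymm : ∀ j k, V j k = V k j := by
    intro j k
    have : T j k = T k j := by
      funext i ω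
      rw [hTeq, hTeq, mul_comm]
    rw [hV]
    simp only [this]
  have hscale : ∀ j k, esqrt (∑ i ∈ Finset.range n, evariance (fun ω =>
      normScoreSummand P X f n θ₀ i ω j * normScoreSummand P X f n θ₀ i ω k) P) =
      (esqrt n)⁻¹ * (esqrt n)⁻¹ * V j k := by
    intro j k
    have e : ∀ i, evariance (fun ω =>
        normScoreSummand P X f n θ₀ i ω j * normScoreSummand P X f n θ₀ i ω k) P =
        ((esqrt n)⁻¹ * (esqrt n)⁻¹) ^ 2 * evariance (T j k i) P := by
      intro i
      have e1 : (fun ω =>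
        normScoreSummand P X f n θ₀ i ω j * normScoreSummand P X f n θ₀ i ω k) =
          fun ω => ((√(n : ℝ))⁻¹ * (√(n : ℝ))⁻¹) * T j k i ω := by
        funext ω
        rw [hTeq, normScoreSummand, normScoreSummand]
        ring
      rw [e1, evariance_mul, ENNReal.ofReal_pow (by positivity), ENNReal.ofReal_mul (by positivity),
        ← Real.enorm_of_nonneg (by positivity), enorm_inv_sqrt_natCast n hn]
    simp_rw [e]
    rw [← Finset.mul_sum, esqrt_mul, esqrt_sq]
  simp_rw [hscale, ← Finset.mul_sum]
  rw [sum_sum_eq_sum_diag_add_two_mul hVsymm, K2]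
  have hdiag : ∀ i j, (fun ω => (∑ k, A j k * score f i k (X i ω) θ₀) ^ 2) = T j j i := by
    intro i j
    funext ω
    rw [hTeq, sq]
  have h4 : (4 : ℝ≥0∞)⁻¹ * 2 = 2⁻¹ := by
    rw [show (4 : ℝ≥0∞) = 2 * 2 by norm_num, ENNReal.mul_inv (by simp) (by simp), mul_assoc,
      ENNReal.inv_mul_cancel (by simp) (by simp), mul_one]
  simp only [← hA, hdiag]
  rw [ENNReal.mul_inv (by simp) (by simp), ENNReal.mul_inv (by simp) (by simp), ← h4]
  simp only [hV, hT]
  ring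

omit [IsProbabilityMeasure P] in
-- The cube scales by `n^{-3/2} = n^{-1/2} · n^{-1}`; `K3` contains the factor `n^{-1}`.
lemma sum_lintegral_cube_eq (hn : 1 ≤ n) :
    12⁻¹ * ∑ i ∈ Finset.range n, ∫⁻ p : Ω × Ω, (∑ m,
      ‖normScoreSummand P X f n θ₀ i p.2 m - normScoreSummand P X f n θ₀ i p.1 m‖ₑ) ^ 3
        ∂(P.prod P) = (esqrt n)⁻¹ * K3 P X f n θ₀ := by
  have e : ∀ (i : ℕ) (p : Ω × Ω), (∑ m,
      ‖normScoreSummand P X f n θ₀ i p.2 m - normScoreSummand P X f n θ₀ i p.1 m‖ₑ) ^ 3 =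
      (esqrt n)⁻¹ ^ 3 * (∑ m, ‖∑ l, invRootFisher P X f n θ₀ m l *
      (score f i l (X i p.2) θ₀ - score f i l (X i p.1) θ₀)‖ₑ) ^ 3 := by
    intro i p
    rw [← mul_pow, Finset.mul_sum]
    congr 1
    refine Finset.sum_congr rfl fun m _ => ?_
    rw [← enorm_inv_sqrt_natCast n hn, ← enorm_mul, normScoreSummand, normScoreSummand,
      ← mul_sub, ← Finset.sum_sub_distrib]
    simp_rw [mul_sub]
  have hq0 : esqrt (n : ℝ≥0∞) ≠ 0 := by
    simp [esqrt, ENNReal.rpow_eq_zero_iff]; omega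
  have hqt : esqrt (n : ℝ≥0∞) ≠ ∞ := by simp [esqrt]
  have hn2 : (n : ℝ≥0∞)⁻¹ = (esqrt n)⁻¹ * (esqrt n)⁻¹ := by
    rw [← ENNReal.mul_inv (.inl hq0) (.inl hqt), esqrt_mul_self]
  simp_rw [e]
  simp_rw [lintegral_const_mul' _ _ (ENNReal.pow_ne_top (ENNReal.inv_ne_top.2 hq0) :
    (esqrt (n : ℝ≥0∞))⁻¹ ^ 3 ≠ ∞)]
  rw [← Finset.mul_sum, K3, ENNReal.mul_inv (by simp) (by simp), hn2]
  ring

omit [IsProbabilityMeasure P] in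
lemma normScore_ae_eq {ξ : ℕ → Ω → Vec d}
    (hξ : ∀ i, ∀ᵐ ω ∂P, ∀ a, ξ i ω a = normScoreSummand P X f n θ₀ i ω a) :
    normScore P X f n θ₀ =ᵐ[P] fun ω => ∑ i ∈ Finset.range n, ξ i ω := by
  filter_upwards [ae_all_iff.2 hξ] with ω hω
  ext a
  rw [normScore_apply]
  simp [hω]

variable (hreg : Regularity P X f Θ θ₀ θhat) (hΘ : IsOpen Θ) (hf : IsModel ν f Θ) (hθ₀ : θ₀ ∈ Θ)
  (hX : IsObservation P X ν f θ₀)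
include hreg hΘ hf hθ₀ hX

lemma integrable_comp_normScore {h : Vec d → ℝ} (hh : IsTestFunction h) :
    Integrable (fun ω => h (normScore P X f n θ₀ ω)) P := by
  obtain ⟨ξ, hξ, -, hξs⟩ := exists_measurable_normScoreSummand hreg hΘ hf hθ₀ hX n
  have hY := normScore_ae_eq hξs
  refine (integrable_comp_of_testFunction hh (Y := fun ω => ∑ i ∈ Finset.range n, ξ i ω)
    (by fun_prop) fun j => ?_).congr (hY.symm.fun_comp h)
  have := integrable_finsetSum (Finset.range n) fun i _ =>
    (memLp_normScoreSummand (n := n) hreg i j).integrable one_le_two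
  refine this.congr ?_
  filter_upwards [ae_all_iff.2 hξs] with ω hω
  simp [hω]

theorem enorm_integral_normScore_sub_stdGaussian_le (hn : 1 ≤ n)
    (hpos : (avgFisher P X f n θ₀).PosDef) {h : Vec d → ℝ} (hh : IsTestFunction h) :
    ‖∫ ω, h (normScore P X f n θ₀ ω) ∂P - ∫ z, h z ∂(stdGaussian (Vec d))‖ₑ ≤
      supNorm2 h / esqrt n * K2 P X f n θ₀ + supNorm3 h / esqrt n * K3 P X f n θ₀ := by
  obtain ⟨ξ, hξ, hind, hξs⟩ := exists_measurable_normScoreSummand hreg hΘ hf hθ₀ hX n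
  have hco : ∀ i a, (fun ω => ξ i ω a) =ᵐ[P] fun ω => normScoreSummand P X f n θ₀ i ω a :=
    fun i a => (hξs i).mono fun ω hω => hω a
  have hco2 : ∀ i a b, (fun ω => ξ i ω a * ξ i ω b) =ᵐ[P] fun ω =>
      normScoreSummand P X f n θ₀ i ω a * normScoreSummand P X f n θ₀ i ω b :=
    fun i a b => (hξs i).mono fun ω hω => by simp only [hω]
  have hmain := enorm_integral_sum_sub_stdGaussian_le (s := Finset.range n) hξ hind
    (fun i j => (memLp_normScoreSummand hreg i j).ae_eq (hco i j).symm)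
    (fun i j => (integral_congr_ae (hco i j)).trans (integral_normScoreSummand hreg i j))
    (fun j k => (Finset.sum_congr rfl fun i _ => integral_congr_ae (hco2 i j k)).trans
      (sum_integral_normScoreSummand_mul hreg hn hpos j k)) hh
  have hlaw : ∫ ω, h (normScore P X f n θ₀ ω) ∂P = ∫ ω, h (∑ i ∈ Finset.range n, ξ i ω) ∂P :=
    integral_congr_ae ((normScore_ae_eq hξs).fun_comp h)
  rw [← hlaw] at hmain
  refine hmain.trans_eq ?_
  have e2 : ∀ i j k, evariance (fun ω => ξ i ω j * ξ i ω k) P = evariance (fun ω =>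
      normScoreSummand P X f n θ₀ i ω j * normScoreSummand P X f n θ₀ i ω k) P :=
    fun i j k => evariance_congr (hco2 i j k)
  have e3 : ∀ i, ∫⁻ p : Ω × Ω, (∑ m, ‖ξ i p.2 m - ξ i p.1 m‖ₑ) ^ 3 ∂(P.prod P) =
      ∫⁻ p : Ω × Ω, (∑ m, ‖normScoreSummand P X f n θ₀ i p.2 m -
        normScoreSummand P X f n θ₀ i p.1 m‖ₑ) ^ 3 ∂(P.prod P) := by
    intro i
    refine lintegral_congr_ae ?_
    filter_upwards [Measure.quasiMeasurePreserving_fst.ae (hξs i),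
      Measure.quasiMeasurePreserving_snd.ae (hξs i)] with p h1 h2
    simp only [h1, h2]
  simp_rw [e2, e3]
  rw [mul_left_comm 4⁻¹, sum_esqrt_evariance_eq hn, mul_left_comm 12⁻¹, sum_lintegral_cube_eq hn,
    div_eq_mul_inv, div_eq_mul_inv, mul_assoc, mul_assoc]

end ScoreApproximation

/-! ### Linearisation of the likelihood equations. -/

section Comparison

variable {Ω : Type*} [MeasurableSpace Ω] {t d : ℕ}
  {P : Measure Ω} {Θ : Set (Vec d)} {ν : ℕ → Measure (Vec t)}
  {f : ℕ → Vec t → Vec d → ℝ} {θ₀ : Vec d} {X : ℕ → Ω → Vec t}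
  {θhat : (n : ℕ) → (Fin n → Vec t) → Vec d} {n : ℕ}

lemma maxDev_lt_iff {θ : Vec d} {ε : ℝ} (hε : 0 < ε) :
    maxDev θ θ₀ < ε ↔ ∀ j, |θ j - θ₀ j| < ε := by
  constructor
  · intro h j
    exact (le_ciSup (f := fun j => |θ j - θ₀ j|) (Set.finite_range _).bddAbove j).trans_lt h
  · intro h
    -- For `d = 0` the real supremum over the empty family is `0`, so positivity of `ε` is needed.
    rcases isEmpty_or_nonempty (Fin d) with hd | hd
    · simpa [maxDev] using hε
    · obtain ⟨j, hj⟩ := exists_eq_ciSup_of_finite (f := fun j => |θ j - θ₀ j|)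
      rw [maxDev, ← hj]
      exact h j

/-- Uses `B^{1/2} = B^{-1/2} B` and `√n = n^{-1/2} n` to bring both vectors under the factor
`n^{-1/2} B^{-1/2}`, with `B = avgFisher`. -/
lemma standardized_sub_normScore (hn : 1 ≤ n) (hpos : (avgFisher P X f n θ₀).PosDef)
    (T : (Fin n → Vec t) → Vec d) (ω : Ω) (l : Fin d) :
    standardized P X f n T θ₀ ω l - normScore P X f n θ₀ ω l =
      (√(n : ℝ))⁻¹ * ∑ k, invRootFisher P X f n θ₀ l k *
        (n * ∑ j, avgFisher P X f n θ₀ k j * (T (sample X n ω) j - θ₀ j) -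
          ∑ i ∈ Finset.range n, score f i k (X i ω) θ₀) := by
  have hn0 : (0 : ℝ) < n := by exact_mod_cast hn
  have hs : √(n : ℝ) = (√(n : ℝ))⁻¹ * n := by
    rw [eq_inv_mul_iff_mul_eq₀ (by positivity), Real.mul_self_sqrt hn0.le]
  set Q : Fin d → ℝ := fun j => T (sample X n ω) j - θ₀ j
  have e1 : standardized P X f n T θ₀ ω l = √(n : ℝ) *
      ∑ k, invRootFisher P X f n θ₀ l k * ∑ j, avgFisher P X f n θ₀ k j * Q j := by
    change √(n : ℝ) * (rootFisher P X f n θ₀).mulVec Q l = _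
    rw [← invRootFisher_mul_avgFisher hpos, ← Matrix.mulVec_mulVec]
    rfl
  have e2 : normScore P X f n θ₀ ω l = (√(n : ℝ))⁻¹ * ∑ k, invRootFisher P X f n θ₀ l k *
    ∑ i ∈ Finset.range n, score f i k (X i ω) θ₀ := rfl
  have e3 : ∀ y, √(n : ℝ) * y = (√(n : ℝ))⁻¹ * (n * y) := fun y => by
    rw [← mul_assoc, ← hs]
  rw [e1, e2, e3, ← mul_sub, Finset.mul_sum, ← Finset.sum_sub_distrib]
  congr 1
  exact Finset.sum_congr rfl fun k _ => by ring

lemma ae_sample_regular (hreg : Regularity P X f Θ θ₀ θhat) (n : ℕ) :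
    ∀ᵐ ω ∂P, (∀ i : Fin n, ∀ θ ∈ Θ, 0 < f i (sample X n ω i) θ) ∧
      (∀ i : Fin n, ∀ θ ∈ Θ, DifferentiableAt ℝ (logDens f i (sample X n ω i)) θ) ∧
      ∀ i : Fin n, ∀ θ ∈ Θ, ∀ b, DifferentiableAt ℝ (pderiv b (logDens f i (sample X n ω i))) θ := by
  filter_upwards [ae_all_iff.2 hreg.pos, ae_all_iff.2 hreg.grad_exists,
    ae_all_iff.2 hreg.hess_exists] with ω h1 h2 h3
  exact ⟨fun i => h1 i, fun i => h2 i, fun i => h3 i⟩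

lemma aemeasurable_hess_logLik (hΘ : IsOpen Θ) (hθ₀ : θ₀ ∈ Θ) (hreg : Regularity P X f Θ θ₀ θhat)
    (n : ℕ) (j k : Fin d) :
    AEMeasurable (fun ω => pderiv j (pderiv k (logLik f n (sample X n ω))) θ₀) P := by
  have h1 : AEMeasurable (fun ω => ∑ i : Fin n, hess f i j k (X i ω) θ₀) P :=
    Finset.aemeasurable_fun_sum _ fun i _ =>
      (hreg.hess_integrable i j k).aestronglyMeasurable.aemeasurable
  refine h1.congr ?_
  filter_upwards [ae_sample_regular hreg n] with ω ⟨hp, hg, hh⟩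
  rw [pderiv_pderiv_logLik hΘ hp hg hh j k hθ₀]
  rfl

/-- The linearisation error of the likelihood equations when the estimator is near `θ₀`. -/
lemma ae_abs_linearisation_le (hΘ : IsOpen Θ) (hθ₀ : θ₀ ∈ Θ) (hreg : Regularity P X f Θ θ₀ θhat)
    (hMLEn : ∀ᵐ ω ∂P, IsUniqueMLE f Θ n (sample X n ω) (θhat n (sample X n ω))) {ε : ℝ}
    (hstar : StarConvex ℝ θ₀ {θ | θ ∈ Θ ∧ ∀ j, |θ j - θ₀ j| < ε})
    {M : Fin d → Fin d → Fin d → (Fin n → Vec t) → ℝ}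
    (hdom : ∀ᵐ ω ∂P, ∀ θ ∈ Θ, (∀ j, |θ j - θ₀ j| < ε) → ∀ k j l,
      DifferentiableAt ℝ (pderiv j (pderiv l (logLik f n (sample X n ω)))) θ ∧
      |pderiv k (pderiv j (pderiv l (logLik f n (sample X n ω)))) θ| ≤ M k j l (sample X n ω))
    (B : Matrix (Fin d) (Fin d) ℝ) :
    ∀ᵐ ω ∂P, (∀ j, |θhat n (sample X n ω) j - θ₀ j| < ε) → ∀ k,
      |n * ∑ j, B k j * (θhat n (sample X n ω) j - θ₀ j) -
          ∑ i ∈ Finset.range n, score f i k (X i ω) θ₀| ≤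
        ∑ j, |θhat n (sample X n ω) j - θ₀ j| *
            |pderiv j (pderiv k (logLik f n (sample X n ω))) θ₀ + n * B k j| +
          1 / 2 * ∑ j, ∑ v, |θhat n (sample X n ω) j - θ₀ j| * |θhat n (sample X n ω) v - θ₀ v| *
            |M k j v (sample X n ω)| := by
  filter_upwards [ae_sample_regular hreg n, hMLEn, hdom] with ω ⟨hp, hg, hh⟩ hmle hd hnear k
  set l := logLik f n (sample X n ω)
  set θ' := θhat n (sample X n ω)
  have hexp := abs_gradient_expansion_le hΘ hstar (l := l)
    (fun θ hθ => differentiableAt_logLik hΘ hp hg hθ)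
    (fun θ hθ b => differentiableAt_pderiv_logLik hΘ hp hg hh b hθ) hd hmle.1 hnear
    (fun k => pderiv_logLik_eq_zero hΘ hp hmle k) k
  have hS : ∑ i ∈ Finset.range n, score f i k (X i ω) θ₀ = pderiv k l θ₀ := by
    rw [pderiv_logLik hΘ hp hg k hθ₀]
    exact (Fin.sum_univ_eq_sum_range (fun i => score f i k (X i ω) θ₀) n).symm
  -- Adding and subtracting the Hessian term isolates the Taylor remainder of the `k`-th likelihood
  -- equation.
  have e : n * ∑ j, B k j * (θ' j - θ₀ j) - ∑ i ∈ Finset.range n, score f i k (X i ω) θ₀ =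
      ∑ j, (θ' j - θ₀ j) * (pderiv j (pderiv k l) θ₀ + n * B k j) -
        (pderiv k l θ₀ + ∑ j, (θ' j - θ₀ j) * pderiv j (pderiv k l) θ₀) := by
    rw [hS, Finset.mul_sum]
    simp_rw [mul_add]
    rw [Finset.sum_add_distrib]
    have : ∀ j, (n : ℝ) * (B k j * (θ' j - θ₀ j)) = (θ' j - θ₀ j) * (n * B k j) := fun j => by ring
    simp_rw [this]
    ring
  rw [e]
  refine (abs_sub _ _).trans (add_le_add ?_ (hexp.trans ?_))
  · refine (Finset.abs_sum_le_sum_abs _ _).trans_eq ?_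
    simp_rw [abs_mul]
  · rw [div_eq_inv_mul, one_div]
    gcongr
    exact le_abs_self _

end Comparison

/-! ### Distance between the standardised estimator and the standardised score. -/

section Transfer

variable {Ω : Type*} [MeasurableSpace Ω] {t d : ℕ}
  {P : Measure Ω} [IsProbabilityMeasure P] {Θ : Set (Vec d)} {ν : ℕ → Measure (Vec t)}
  {f : ℕ → Vec t → Vec d → ℝ} {θ₀ : Vec d} {X : ℕ → Ω → Vec t}
  {θhat : (n : ℕ) → (Fin n → Vec t) → Vec d} {n : ℕ}

/-- Conditioning divides by a probability at most `1`, so it only enlarges the integral; the null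
event causes no trouble, as `0⁻¹ = ∞`. -/
lemma setLIntegral_near_le_condNear (T : (Fin n → Vec t) → Vec d) (ε : ℝ) (g : Ω → ℝ≥0∞) :
    ∫⁻ ω in {ω | maxDev (T (sample X n ω)) θ₀ < ε}, g ω ∂P ≤
      ∫⁻ ω, g ω ∂(condNear P X n T θ₀ ε) := by
  rw [condNear, ProbabilityTheory.cond, lintegral_smul_measure]
  exact le_mul_of_one_le_left' (ENNReal.one_le_inv.2 prob_le_one)

/-- The standardised estimator is close to the standardised score. -/
theorem lintegral_enorm_standardized_sub_normScore_le (hΘ : IsOpen Θ) (hθ₀ : θ₀ ∈ Θ)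
    (hX : IsObservation P X ν f θ₀) (hmeas : Measurable (θhat n))
    (hreg : Regularity P X f Θ θ₀ θhat) (hn : 1 ≤ n)
    (hMLEn : ∀ᵐ ω ∂P, IsUniqueMLE f Θ n (sample X n ω) (θhat n (sample X n ω)))
    (hpos : (avgFisher P X f n θ₀).PosDef) {ε : ℝ} (hε : 0 < ε)
    (hstar : StarConvex ℝ θ₀ {θ | θ ∈ Θ ∧ ∀ j, |θ j - θ₀ j| < ε})
    {M : Fin d → Fin d → Fin d → (Fin n → Vec t) → ℝ} (hM : ∀ k j l, Measurable (M k j l))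
    (hdom : ∀ᵐ ω ∂P, ∀ θ ∈ Θ, (∀ j, |θ j - θ₀ j| < ε) → ∀ k j l,
      DifferentiableAt ℝ (pderiv j (pderiv l (logLik f n (sample X n ω)))) θ ∧
      |pderiv k (pderiv j (pderiv l (logLik f n (sample X n ω)))) θ| ≤ M k j l (sample X n ω))
    {h : Vec d → ℝ} (hh : IsTestFunction h) :
    ∫⁻ ω, ‖h (standardized P X f n (θhat n) θ₀ ω) - h (normScore P X f n θ₀ ω)‖ₑ ∂P ≤
      supNorm1 h / esqrt n * K1 P X f n (θhat n) θ₀ ε M +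
        2 * supNorm h / ENNReal.ofReal (ε ^ 2) *
          ∫⁻ ω, ∑ j, ‖θhat n (sample X n ω) j - θ₀ j‖ₑ ^ 2 ∂P := by
  have hsample : Measurable (sample X n) := measurable_pi_lambda _ fun i => hX.measurable i
  set A := invRootFisher P X f n θ₀ with hA
  set B := avgFisher P X f n θ₀ with hB
  set Q : Ω → Fin d → ℝ := fun ω j => θhat n (sample X n ω) j - θ₀ j with hQdef
  set H : Fin d → Fin d → Ω → ℝ := fun k j ω =>
    pderiv j (pderiv k (logLik f n (sample X n ω))) θ₀ + n * B k j with hH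
  set E : Set Ω := {ω | maxDev (θhat n (sample X n ω)) θ₀ < ε} with hE
  have hQ : ∀ j, Measurable fun ω => Q ω j := fun j => by
    have : Measurable fun ω => θhat n (sample X n ω) := hmeas.comp hsample
    fun_prop
  have hHm : ∀ k j, AEMeasurable (H k j) P := fun k j =>
    (aemeasurable_hess_logLik hΘ hθ₀ hreg n j k).add_const _
  have hMm : ∀ k j v, Measurable fun ω => M k j v (sample X n ω) := fun k j v =>
    (hM k j v).comp hsample
  have hEiff : ∀ ω, ω ∈ E ↔ ∀ j, |Q ω j| < ε := fun ω => maxDev_lt_iff hε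
  have hEm : MeasurableSet E := by
    have : E = ⋂ j, {ω | |Q ω j| < ε} := by
      ext ω
      simp [hEiff]
    rw [this]
    exact MeasurableSet.iInter fun j => measurableSet_lt (hQ j).abs measurable_const
  -- The indicator is kept on `M` alone, so that after Cauchy-Schwarz only the factor with `M` is
  -- restricted to the event `E`.
  set D : Fin d → Ω → ℝ≥0∞ := fun k ω => ∑ j, ‖Q ω j‖ₑ * ‖H k j ω‖ₑ +
    2⁻¹ * ∑ j, ∑ v, ‖Q ω j‖ₑ * ‖Q ω v‖ₑ * E.indicator (fun ω => ‖M k j v (sample X n ω)‖ₑ) ω with hD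
  have hD1 : ∀ k j, AEMeasurable (fun ω => ‖Q ω j‖ₑ * ‖H k j ω‖ₑ) P := fun k j =>
    (hQ j).enorm.aemeasurable.mul (hHm k j).enorm
  have hD2 : ∀ k j v, Measurable fun ω => ‖Q ω j‖ₑ * ‖Q ω v‖ₑ *
      E.indicator (fun ω => ‖M k j v (sample X n ω)‖ₑ) ω := fun k j v =>
    ((hQ j).enorm.mul (hQ v).enorm).mul ((hMm k j v).enorm.indicator hEm)
  have hD2s : ∀ k, Measurable fun ω => ∑ j, ∑ v, ‖Q ω j‖ₑ * ‖Q ω v‖ₑ *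
      E.indicator (fun ω => ‖M k j v (sample X n ω)‖ₑ) ω := fun k =>
    Finset.measurable_sum _ fun j _ => Finset.measurable_sum _ fun v _ => hD2 k j v
  have hDm : ∀ k, AEMeasurable (D k) P := fun k =>
    (Finset.aemeasurable_fun_sum _ fun j _ => hD1 k j).add ((hD2s k).const_mul _).aemeasurable
  have hpt : ∀ᵐ ω ∂P,
      ‖h (standardized P X f n (θhat n) θ₀ ω) - h (normScore P X f n θ₀ ω)‖ₑ ≤
        supNorm1 h / esqrt n * (∑ k, ∑ l, ‖A l k‖ₑ * D k ω) +
          2 * supNorm h / ENNReal.ofReal (ε ^ 2) * ∑ j, ‖Q ω j‖ₑ ^ 2 := by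
    filter_upwards [ae_abs_linearisation_le hΘ hθ₀ hreg hMLEn hstar hdom B] with ω hω
    by_cases hωE : ω ∈ E
    · refine le_add_right ?_
      have hlin := hω ((hEiff ω).1 hωE)
      have hDle : ∀ k, ‖n * ∑ j, B k j * Q ω j -
          ∑ i ∈ Finset.range n, score f i k (X i ω) θ₀‖ₑ ≤ D k ω := by
        intro k
        rw [Real.enorm_eq_ofReal_abs]
        refine (ENNReal.ofReal_le_ofReal (hlin k)).trans_eq ?_
        rw [ENNReal.ofReal_add (by positivity) (by positivity),
          ENNReal.ofReal_mul (by norm_num), ENNReal.ofReal_sum_of_nonneg fun _ _ => by positivity,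
          ENNReal.ofReal_sum_of_nonneg fun _ _ => by positivity]
        simp only [hD, Set.indicator_of_mem hωE, Real.enorm_eq_ofReal_abs]
        congr 1
        · exact Finset.sum_congr rfl fun j _ => ENNReal.ofReal_mul (abs_nonneg _)
        · congr 1
          · simp [ENNReal.ofReal_inv_of_pos]
          · refine Finset.sum_congr rfl fun j _ => ?_
            rw [ENNReal.ofReal_sum_of_nonneg fun _ _ => by positivity]
            refine Finset.sum_congr rfl fun v _ => ?_
            rw [ENNReal.ofReal_mul (by positivity), ENNReal.ofReal_mul (by positivity)]
      refine (hh.enorm_sub_le _ _).trans ?_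
      rw [div_eq_mul_inv, mul_assoc]
      gcongr
      rw [Finset.sum_comm, Finset.mul_sum]
      refine Finset.sum_le_sum fun l _ => ?_
      rw [standardized_sub_normScore hn hpos, enorm_mul, enorm_inv_sqrt_natCast n hn]
      gcongr
      refine (enorm_sum_le _ _).trans (Finset.sum_le_sum fun k _ => ?_)
      rw [enorm_mul]
      gcongr
      exact hDle k
    · refine le_add_left ?_
      -- Markov's inequality in pointwise form: off `E` one coordinate is at least `ε`, so `∑ Q_j² /
      -- ε² ≥ 1` absorbs the bound `2‖h‖`.
      obtain ⟨j, hj⟩ : ∃ j, ε ≤ |Q ω j| := by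
        by_contra! hcon
        exact hωE ((hEiff ω).2 hcon)
      have hε2 : ENNReal.ofReal (ε ^ 2) ≤ ∑ j, ‖Q ω j‖ₑ ^ 2 := by
        refine le_trans ?_ (Finset.single_le_sum (f := fun j => ‖Q ω j‖ₑ ^ 2)
          (fun _ _ => zero_le) (Finset.mem_univ j))
        rw [Real.enorm_eq_ofReal_abs, ← ENNReal.ofReal_pow (abs_nonneg _)]
        exact ENNReal.ofReal_le_ofReal (by gcongr)
      have hε0 : ENNReal.ofReal (ε ^ 2) ≠ 0 := by simp [hε.ne']
      calc _ ≤ 2 * supNorm h := by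
            refine (enorm_sub_le).trans ?_
            rw [two_mul]
            exact add_le_add (enorm_le_supNorm _ _) (enorm_le_supNorm _ _)
        _ = 2 * supNorm h / ENNReal.ofReal (ε ^ 2) * ENNReal.ofReal (ε ^ 2) :=
            (ENNReal.div_mul_cancel hε0 ENNReal.ofReal_ne_top).symm
        _ ≤ _ := by gcongr
  have hDint : ∀ k, ∫⁻ ω, D k ω ∂P ≤
      ∑ j, esqrt ((∫⁻ ω, ‖Q ω j‖ₑ ^ 2 ∂P) * ∫⁻ ω, ‖H k j ω‖ₑ ^ 2 ∂P) +
      2⁻¹ * ∑ j, ∑ v, esqrt (∫⁻ ω, ‖Q ω j‖ₑ ^ 2 * ‖Q ω v‖ₑ ^ 2 ∂P) *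
        esqrt (∫⁻ ω, ‖M k j v (sample X n ω)‖ₑ ^ 2 ∂(condNear P X n (θhat n) θ₀ ε)) := by
    intro k
    rw [hD]
    rw [lintegral_add_right _ ((hD2s k).const_mul _), lintegral_finsetSum' _ fun j _ => hD1 k j,
      lintegral_const_mul _ (hD2s k), lintegral_finsetSum _ fun j _ =>
        Finset.measurable_sum _ fun v _ => hD2 k j v]
    gcongr with j _ j _
    · rw [esqrt_mul]
      exact lintegral_mul_le_esqrt P (hQ j).enorm.aemeasurable (hHm k j).enorm
    · rw [lintegral_finsetSum _ fun v _ => hD2 k j v]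
      refine Finset.sum_le_sum fun v _ => ?_
      refine (lintegral_mul_le_esqrt P (f := fun ω => ‖Q ω j‖ₑ * ‖Q ω v‖ₑ) ((hQ j).enorm.mul (hQ v).enorm).aemeasurable
        ((hMm k j v).enorm.indicator hEm).aemeasurable).trans ?_
      simp_rw [mul_pow]
      gcongr
      refine esqrt_mono ?_
      have e : ∀ ω, E.indicator (fun ω => ‖M k j v (sample X n ω)‖ₑ) ω ^ 2 =
          E.indicator (fun ω => ‖M k j v (sample X n ω)‖ₑ ^ 2) ω := by
        intro ω
        by_cases hω : ω ∈ E <;> simp [hω]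
      simp_rw [e]
      rw [lintegral_indicator hEm]
      exact setLIntegral_near_le_condNear (θhat n) ε _
  have hsumm : AEMeasurable (fun ω => ∑ k, ∑ l, ‖A l k‖ₑ * D k ω) P :=
    Finset.aemeasurable_fun_sum _ fun k _ => Finset.aemeasurable_fun_sum _ fun l _ =>
      (hDm k).const_mul _
  have hQs : Measurable fun ω => ∑ j, ‖Q ω j‖ₑ ^ 2 :=
    Finset.measurable_sum _ fun j _ => (hQ j).enorm.pow_const 2
  refine (lintegral_mono_ae hpt).trans ?_
  rw [lintegral_add_right _ (hQs.const_mul _), lintegral_const_mul _ hQs,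
    lintegral_const_mul'' _ hsumm, lintegral_finsetSum' _ fun k _ =>
      Finset.aemeasurable_fun_sum _ fun l _ => (hDm k).const_mul _]
  gcongr
  have hK1 : K1 P X f n (θhat n) θ₀ ε M = ∑ k, ∑ l, ‖A l k‖ₑ *
      (∑ j, esqrt ((∫⁻ ω, ‖Q ω j‖ₑ ^ 2 ∂P) * ∫⁻ ω, ‖H k j ω‖ₑ ^ 2 ∂P) +
      2⁻¹ * ∑ j, ∑ v, esqrt (∫⁻ ω, ‖Q ω j‖ₑ ^ 2 * ‖Q ω v‖ₑ ^ 2 ∂P) *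
        esqrt (∫⁻ ω, ‖M k j v (sample X n ω)‖ₑ ^ 2 ∂(condNear P X n (θhat n) θ₀ ε))) := by
    simp only [mul_add, Finset.sum_add_distrib, mul_left_comm _ (2⁻¹ : ℝ≥0∞), ← Finset.mul_sum]
    rfl
  rw [hK1]
  refine Finset.sum_le_sum fun k _ => ?_
  rw [lintegral_finsetSum' _ fun l _ => (hDm k).const_mul _]
  refine Finset.sum_le_sum fun l _ => ?_
  rw [lintegral_const_mul' _ _ enorm_ne_top]
  gcongr
  exact hDint k

end Transfer

end MLEBound

/-! ### The two comparisons combined. -/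

open MLEBound in
theorem mainTheorem1 {Ω : Type*} [MeasurableSpace Ω] (P : Measure Ω) [IsProbabilityMeasure P]
    {t d : ℕ} (Θ : Set (Vec d)) (hΘ : IsOpen Θ)
    (ν : ℕ → Measure (Vec t)) (f : ℕ → Vec t → Vec d → ℝ) (hf : IsModel ν f Θ)
    (θ₀ : Vec d) (hθ₀ : θ₀ ∈ Θ)
    (X : ℕ → Ω → Vec t) (hX : IsObservation P X ν f θ₀)
    (θhat : (n : ℕ) → (Fin n → Vec t) → Vec d) (hmeas : ∀ n, Measurable (θhat n))
    (hMLE : ∀ᶠ m in atTop, ∀ᵐ ω ∂P, IsUniqueMLE f Θ m (sample X m ω) (θhat m (sample X m ω)))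
    (hreg : Regularity P X f Θ θ₀ θhat)
    (n : ℕ) (hn : 1 ≤ n)
    (hMLEn : ∀ᵐ ω ∂P, IsUniqueMLE f Θ n (sample X n ω) (θhat n (sample X n ω)))
    (hpos : (avgFisher P X f n θ₀).PosDef)
    (ε : ℝ) (hε : 0 < ε)
    (hstar : StarConvex ℝ θ₀ {θ | θ ∈ Θ ∧ ∀ j, |θ j - θ₀ j| < ε})
    (M : Fin d → Fin d → Fin d → (Fin n → Vec t) → ℝ) (hM : ∀ k j l, Measurable (M k j l))
    (hdom : ∀ᵐ ω ∂P, ∀ θ ∈ Θ, (∀ j, |θ j - θ₀ j| < ε) → ∀ k j l,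
      DifferentiableAt ℝ (pderiv j (pderiv l (logLik f n (sample X n ω)))) θ ∧
      |pderiv k (pderiv j (pderiv l (logLik f n (sample X n ω)))) θ| ≤ M k j l (sample X n ω))
    (hM2 : ∀ k j v, ∫⁻ ω, ‖M k j v (sample X n ω)‖ₑ ^ 2 ∂(condNear P X n (θhat n) θ₀ ε) < ∞)
    (h : Vec d → ℝ) (hh : IsTestFunction h) :
    ENNReal.ofReal |∫ ω, h (standardized P X f n (θhat n) θ₀ ω) ∂P - ∫ z, h z ∂(stdGaussian (Vec d))|
      ≤ supNorm1 h / esqrt n * K1 P X f n (θhat n) θ₀ ε M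
        + supNorm2 h / esqrt n * K2 P X f n θ₀
        + supNorm3 h / esqrt n * K3 P X f n θ₀
        + 2 * supNorm h / ENNReal.ofReal (ε ^ 2) *
          ∫⁻ ω, ∑ j, ‖θhat n (sample X n ω) j - θ₀ j‖ₑ ^ 2 ∂P := by
  set K := supNorm1 h / esqrt n * K1 P X f n (θhat n) θ₀ ε M +
    2 * supNorm h / ENNReal.ofReal (ε ^ 2) *
      ∫⁻ ω, ∑ j, ‖θhat n (sample X n ω) j - θ₀ j‖ₑ ^ 2 ∂P with hK
  have hcomp := lintegral_enorm_standardized_sub_normScore_le hΘ hθ₀ hX (hmeas n) hreg hn hMLEn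
    hpos hε hstar hM hdom hh
  have hscore := enorm_integral_normScore_sub_stdGaussian_le hreg hΘ hf hθ₀ hX hn hpos hh
  have hi := integrable_comp_normScore (n := n) hreg hΘ hf hθ₀ hX hh
  have hstd : ‖∫ ω, h (standardized P X f n (θhat n) θ₀ ω) ∂P -
      ∫ ω, h (normScore P X f n θ₀ ω) ∂P‖ₑ ≤ K := by
    -- Only a finite `K` gives integrability of `h` at the standardised estimator, by adding the
    -- integrable difference to `h` at the score; without it the integrals could not be subtracted.
    -- For infinite `K` nothing is to be shown.
    rcases eq_or_ne K ∞ with htop | htop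
    · rw [htop]
      exact le_top
    have hsample : Measurable (sample X n) := measurable_pi_lambda _ fun i => hX.measurable i
    have hT : Measurable fun ω => θhat n (sample X n ω) := (hmeas n).comp hsample
    have hstdm : Measurable (standardized P X f n (θhat n) θ₀) := by
      refine (WithLp.measurable_toLp 2 _).comp (measurable_pi_lambda _ fun a => ?_)
      simp only [Pi.smul_apply, Matrix.mulVec, dotProduct]
      fun_prop
    have hdiff : Integrable (fun ω => h (standardized P X f n (θhat n) θ₀ ω) -
        h (normScore P X f n θ₀ ω)) P :=
      ⟨(hh.continuous.measurable.comp hstdm).aestronglyMeasurable.sub hi.aestronglyMeasurable,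
        hcomp.trans_lt (lt_top_iff_ne_top.2 htop)⟩
    have hi' : Integrable (fun ω => h (standardized P X f n (θhat n) θ₀ ω)) P :=
      (hdiff.add hi).congr (.of_forall fun ω => sub_add_cancel _ _)
    rw [← integral_sub hi' hi]
    exact (enorm_integral_le_lintegral_enorm _).trans hcomp
  rw [← Real.enorm_eq_ofReal_abs, ← sub_add_sub_cancel _ (∫ ω, h (normScore P X f n θ₀ ω) ∂P)]
  refine (enorm_add_le _ _).trans ((add_le_add hstd hscore).trans_eq ?_)
  rw [hK]
  ring
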